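/- **Conventions.** $\mathbb R^d$ ($d\in\mathbb N$) carries the supremum norm. $\mathscr Q_n$ is the set of cubes $\prod_i[\frac{a_i}{2^n},\frac{a_i+1}{2^n}]$ with $a\in\mathbb Z^d$; $|S|$ is the union of a set $S$ of cubes; $\mathscr B_n\subseteq\mathscr Q_n$ is the finite set of cubes that meet $[-2^n,2^n]^d$, and $C_n=\mathscr Q_n\setminus\mathscr B_n$. $B\Subset B'$ means $\overline B\subseteq\operatorname{int}B'$; for a set-valued map $F$, $F(S)=\bigcup_{Q\in S}F(Q)$. **Names.** A *name of a point* $x\in\mathbb R^d$ is a sequence of finite sets $X_n\subseteq\mathscr Q_n$ with $x\in\operatorname{int}|X_n|$, $|X_{n+1}|\subseteq|X_n|$ and $\operatorname{diam}|X_n|\to0$. A *name of a continuous map* $f:\mathbb R^d\to\mathbb R^d$ is a sequence of maps $F_n$ from $\mathscr B_n$ to finite subsets of $\mathscr Q_n$ such that (i) $f(Q)\subseteq\operatorname{int}|F_n(Q)|$ for $Q\in\mathscr B_n$; (ii) $|F_{n+1}(Q')|\subseteq|F_n(Q)|$ if $Q\in\mathscr B_n$, $Q'\in\mathscr B_{n+1}$,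 $Q'\subseteq Q$; (iii) $\operatorname{diam}|F_n(Q_n)|\to0$ for every sequence $(Q_n)_{n\ge m}$ with $Q_n\in\mathscr B_n$, $Q_{n+1}\subseteq Q_n$ and $\operatorname{diam}Q_n\to0$. A *name of a closed set* $A\subseteq\mathbb R^d$ is a sequence of pairs of finite sets $I_n,E_n\subseteq\mathscr Q_n$ with $|I_n|\Subset A$, $\operatorname{int}A=\bigcup_n\operatorname{int}|I_n|$, $|E_n|\Subset\mathbb R^d\setminus A$, $\mathbb R^d\setminus A=\bigcup_n\operatorname{int}|E_n|$, and such that every $Q'\in\mathscr Q_{n+1}$ contained in some $Q\in I_n$ (resp. $E_n$) is in $I_{n+1}$ (resp. $E_{n+1}$). Finite objects are coded by natural numbers, so names are elements of $\mathbb N^{\mathbb N}$; a name of an instance $(d,f,A,x_0)$ consists of $d$ and names of $f$, $A$, $x_0$. Each represented space carries the final topology: a set is open iff the set of names of its elements is open in the set of all names (with the subspace topology of the product topology on $\mathbb N^{\mathbb N}$). All convergence and boundaries below refer to it. **Point Escape Problem.** An instance is $(d,f,A,x_0)$ with $f:\mathbb R^d\to\mathbb R^d$ continuous, $A\subseteq\mathbb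 R^d$ closed and $x_0\in A$. The point $x_0$ *escapes* $A$ under $f$ if $f^n(x_0)\notin A$ for some $n\in\mathbb N$; otherwise it is *trapped*. A *robust invariant* for $f$ is a compact set $V$ with $f(V)\subseteq\operatorname{int}V$. **Algorithm 1.** Input: names $(F_n)$, $(I_n,E_n)$, $(X_n)$. For $n=0,1,\dots$ run stage $n$ until a stage returns Escapes or Trapped, and return that answer. Stage $n$: if $|X_n|\cap|C_n|\ne\emptyset$ return Unknown. Let $Q_1=O_1=F_n(X_n)$ and $P_1=\{Q\in Q_1: Q\not\Subset|E_n|\}$; if $Q_1\cap C_n\neq\emptyset$ return Unknown. For $i=1,2,\dots$: let $Q_{i+1}=F_n(Q_i)$, $P_{i+1}=\{Q\in F_n(P_i):Q\not\Subset|E_n|\}$, $O_{i+1}=O_i\cup Q_{i+1}$. If $P_{i+1}=\emptyset$ return Escapes; else if $Q_{i+1}\cap C_n\ne\emptyset$ return Unknown; else if $O_i=O_{i+1}$, return Trapped if $|O_i|\Subset|I_n|$, and Unknown otherwise. **Decision methods.** A *decision method* for a subset $S$ of a represented space is an oracle program (with the name as oracle) that, whenever it halts on a name of $x$, outputs $1$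 if $x\in S$ and $0$ if $x\notin S$. Its *halting set* is the set of all $x$ such that it halts on all names of $x$. It is *complete* if its halting set is the complement of the boundary $\partial S$. **Theorem.** Let $A\subseteq\mathbb R^d$ be closed, $f:\mathbb R^d\to\mathbb R^d$ continuous and $x_0\in A$, and run Algorithm 1 on names of $f$, $A$ and $x_0$. 1. If the algorithm halts, it correctly reports whether $x_0$ escapes or is trapped. 2. If $x_0$ escapes $A$ under $f$, then the algorithm halts. 3. If $f(x_0)\in\operatorname{int}V$ for some robust invariant $V$ of $f$ with $V\subseteq\operatorname{int}A$, then the algorithm halts. 4. If the algorithm does not halt, then there are sequences of continuous maps $f_{0,n}\to f$, $f_{1,n}\to f$ and of closed sets $A_{0,n}\to A$, $A_{1,n}\to A$ with $x_0\in A_{0,n}\cap A_{1,n}$ such that, for all $n$, $x_0$ escapes $A_{0,n}$ under $f_{0,n}$ and is trapped in $A_{1,n}$ under $f_{1,n}$. Moreover, if $A\neq\mathbb R^d$, one can choose $A_{0,n}=A_{1,n}=A$ for all $n$. In particular, Algorithm 1 is a complete decision method for the Point Escape Problem: there is an oracle program which on every name of every instance behaves like Algorithm 1 (output $1$ for Escapes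 and $0$ for Trapped, and running forever if Algorithm 1 does), this program is a complete decision method for the set of escaping instances, and its halting set contains the halting set of every decision method for the set of escaping instances. -/

import Mathlib

open Set Filter Topology

noncomputable section

namespace PointEscape

/-! ### Dyadic cubes -/

/-- The space `ℝ^d` with the supremum norm. -/
abbrev Space (d : ℕ) : Type := Fin d → ℝ

/-- Indices of dyadic cubes: at level `n` the index `a` stands for the cube
`∏ i, [a i / 2 ^ n, (a i + 1) / 2 ^ n]`, so the cubes of side length `2 ^ (-n)` are in bijection
with their indices. -/
abbrev Cube (d : ℕ) : Type := Fin d → ℤ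

variable {d : ℕ}

/-- The dyadic cube of level `n` with index `a`. -/
def cube (n : ℕ) (a : Cube d) : Set (Space d) :=
  {x | ∀ i, (a i : ℝ) / 2 ^ n ≤ x i ∧ x i ≤ ((a i : ℝ) + 1) / 2 ^ n}

/-- `|S|`: the union of a set of cubes of level `n`. -/
def body (n : ℕ) (S : Set (Cube d)) : Set (Space d) := ⋃ a ∈ S, cube n a

/-- `[-2 ^ n, 2 ^ n] ^ d`. -/
def box (d n : ℕ) : Set (Space d) := {x | ∀ i, -(2 : ℝ) ^ n ≤ x i ∧ x i ≤ 2 ^ n}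

/-- The finite set of all cubes of level `n` that meet `[-2 ^ n, 2 ^ n] ^ d`. -/
def boxCubes (d n : ℕ) : Set (Cube d) := {a | (cube n a ∩ box d n).Nonempty}

/-- `A ⋐ B`: the closure of `A` is contained in the interior of `B`. -/
def WellInside (A B : Set (Space d)) : Prop := closure A ⊆ interior B

/-- The image `F(S)` of a finite set under a finite-set-valued map. -/
def setImage (F : Cube d → Finset (Cube d)) (S : Finset (Cube d)) : Finset (Cube d) := S.biUnion F

/-! ### Names of points, continuous functions and closed sets -/

/-- `(X n)` is a name of the point `x`; the elements of `X n` are cubes of level `n`. -/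
structure IsPointName (X : ℕ → Finset (Cube d)) (x : Space d) : Prop where
  mem_interior : ∀ n, x ∈ interior (body n (X n : Set (Cube d)))
  antitone : ∀ n, body (n + 1) (X (n + 1) : Set (Cube d)) ⊆ body n (X n : Set (Cube d))
  diam_tendsto :
    Tendsto (fun n => Metric.diam (body n (X n : Set (Cube d)))) atTop (𝓝 0)

/-- `(F n)` is a name of the continuous function `f`. `F n` sends cubes of level `n` to finite sets
of cubes of level `n`. Only its values on `boxCubes d n` matter, i.e. `F n` stands for its
restriction to `boxCubes d n`. -/
structure IsFunctionName (F : ℕ → Cube d → Finset (Cube d)) (f : C(Space d, Space d)) : Prop where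
  image_subset : ∀ n, ∀ a ∈ boxCubes d n,
    f '' cube n a ⊆ interior (body n (F n a : Set (Cube d)))
  antitone : ∀ n, ∀ a ∈ boxCubes d n, ∀ b ∈ boxCubes d (n + 1), cube (n + 1) b ⊆ cube n a →
    body (n + 1) (F (n + 1) b : Set (Cube d)) ⊆ body n (F n a : Set (Cube d))
  diam_tendsto : ∀ (m : ℕ) (Q : ℕ → Cube d),
    (∀ n, m ≤ n → Q n ∈ boxCubes d n) →
    (∀ n, m ≤ n → cube (n + 1) (Q (n + 1)) ⊆ cube n (Q n)) →
    Tendsto (fun n => Metric.diam (cube n (Q n))) atTop (𝓝 0) →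
    Tendsto (fun n => Metric.diam (body n (F n (Q n) : Set (Cube d)))) atTop (𝓝 0)

/-- `(I n, E n)` is a name of the closed set `A`; the elements of `I n` and `E n` are cubes of
level `n`. -/
structure IsClosedName (I E : ℕ → Finset (Cube d)) (A : TopologicalSpace.Closeds (Space d)) :
    Prop where
  inner_wellInside : ∀ n, WellInside (body n (I n : Set (Cube d))) (A : Set (Space d))
  interior_eq : interior (A : Set (Space d)) = ⋃ n, interior (body n (I n : Set (Cube d)))
  outer_wellInside : ∀ n, WellInside (body n (E n : Set (Cube d))) (A : Set (Space d))ᶜ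
  compl_eq : (A : Set (Space d))ᶜ = ⋃ n, interior (body n (E n : Set (Cube d)))
  inner_refine : ∀ n, ∀ a ∈ I n, ∀ b : Cube d, cube (n + 1) b ⊆ cube n a → b ∈ I (n + 1)
  outer_refine : ∀ n, ∀ a ∈ E n, ∀ b : Cube d, cube (n + 1) b ⊆ cube n a → b ∈ E (n + 1)

/-! ### The Point Escape Algorithm -/

/-- The two answers that the algorithm may return. -/
inductive Answer : Type
  | escapes : Answer
  | trapped : Answer

/-- The variables `Q_i`, `P_i`, `O_i` of the loop inside one stage. -/
structure LoopState (d : ℕ) : Type where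
  Q : Finset (Cube d)
  P : Finset (Cube d)
  O : Finset (Cube d)

open Classical in
/-- The cubes in `S` that are not well inside `|E|`. -/
def notExcluded (n : ℕ) (E S : Finset (Cube d)) : Finset (Cube d) :=
  S.filter fun a => ¬ WellInside (cube n a) (body n (E : Set (Cube d)))

/-- The initial values `Q_1 = F(X)`, `P_1 = {Q ∈ Q_1 | ¬ Q ⋐ |E|}`, `O_1 = Q_1`. -/
def initState (n : ℕ) (F : Cube d → Finset (Cube d)) (E X : Finset (Cube d)) : LoopState d where
  Q := setImage F X
  P := notExcluded n E (setImage F X)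
  O := setImage F X

/-- The values `Q_{i+1} = F(Q_i)`, `P_{i+1} = {Q ∈ F(P_i) | ¬ Q ⋐ |E|}`,
`O_{i+1} = O_i ∪ Q_{i+1}`. -/
def nextState (n : ℕ) (F : Cube d → Finset (Cube d)) (E : Finset (Cube d)) (s : LoopState d) :
    LoopState d where
  Q := setImage F s.Q
  P := notExcluded n E (setImage F s.P)
  O := s.O ∪ setImage F s.Q

open Classical in
/-- The tests in the body of the loop, with `s` the values of index `i` and `t` those of index
`i + 1`. The result `none` means that the loop continues, `some none` that the stage returns
`Unknown`, and `some (some r)` that the stage returns `r`. -/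
def loopTests (n : ℕ) (I : Finset (Cube d)) (s t : LoopState d) : Option (Option Answer) :=
  if t.P = ∅ then some (some Answer.escapes)
  else if ((t.Q : Set (Cube d)) ∩ (boxCubes d n)ᶜ).Nonempty then some none
  else if s.O = t.O then
    if WellInside (body n (s.O : Set (Cube d))) (body n (I : Set (Cube d))) then
      some (some Answer.trapped)
    else some none
  else none

open Classical in
/-- The `n`-th stage; the result `none` means `Unknown`. The loop variable `i = 1, 2, …` is
`j + 1`. -/
def stage (n : ℕ) (F : Cube d → Finset (Cube d)) (I E X : Finset (Cube d)) :
    Part (Option Answer) :=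
  if (body n (X : Set (Cube d)) ∩ body n (boxCubes d n)ᶜ).Nonempty then Part.some none
  else if ((setImage F X : Set (Cube d)) ∩ (boxCubes d n)ᶜ).Nonempty then Part.some none
  else Nat.rfindOpt fun j =>
    loopTests n I ((nextState n F E)^[j] (initState n F E X))
      ((nextState n F E)^[j + 1] (initState n F E X))

/-- The Point Escape Algorithm: run the stages `0, 1, 2, …` until one of them returns an answer.
It halts iff the value is defined. -/
def pointEscape (F : ℕ → Cube d → Finset (Cube d)) (I E X : ℕ → Finset (Cube d)) : Part Answer :=
  (Nat.rfind fun n => (stage n (F n) (I n) (E n) (X n)).map Option.isSome).bind fun n =>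
    (stage n (F n) (I n) (E n) (X n)).bind fun r => (r : Part Answer)

/-! ### Escaping, trapped, robust invariants -/

/-- `x` escapes `A` under `f`. -/
def Escapes (f : C(Space d, Space d)) (A : TopologicalSpace.Closeds (Space d)) (x : Space d) :
    Prop :=
  ∃ n : ℕ, f^[n] x ∉ A

/-- `x` is trapped in `A` under `f`. -/
def Trapped (f : C(Space d, Space d)) (A : TopologicalSpace.Closeds (Space d)) (x : Space d) :
    Prop :=
  ∀ n : ℕ, f^[n] x ∈ A

/-- `V` is a robust invariant for `f`. -/
def IsRobustInvariant (f : C(Space d, Space d)) (V : Set (Space d)) : Prop :=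
  IsCompact V ∧ f '' V ⊆ interior V

/-! ### Represented spaces

A representation of `X` is given by the relation "`p` is a name of `x`" between `ℕ → ℕ` and `X`. -/

/-- The final topology of a representation: the set of names carries the subspace topology of the
product topology on `ℕ → ℕ`, and a set is open iff the set of its names is open. -/
@[reducible]
def finalTopology {X : Type*} (IsName : (ℕ → ℕ) → X → Prop) : TopologicalSpace X :=
  TopologicalSpace.coinduced
    (fun q : {q : (ℕ → ℕ) × X // IsName q.1 q.2} => q.1.2)
    (TopologicalSpace.induced
      (fun q : {q : (ℕ → ℕ) × X // IsName q.1 q.2} => q.1.1) inferInstance)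

/-- Convergence of a sequence in the final topology of a representation. -/
def Converges {X : Type*} (IsName : (ℕ → ℕ) → X → Prop) (u : ℕ → X) (x : X) : Prop :=
  Tendsto u atTop (@nhds X (finalTopology IsName) x)

/-- Read a list of integers as an index in `ℤ ^ d` (cut off, or padded with zeros). -/
def cubeOfList (d : ℕ) (l : List ℤ) : Cube d := fun i => l.getD i 0

/-- The finite set of cubes that is coded by a list. -/
def cubesOfList (d : ℕ) (L : List (List ℤ)) : Finset (Cube d) :=
  (L.map (cubeOfList d)).toFinset

/-- The finite set of cubes with code `k`; every natural number codes a list of lists of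
integers. -/
def decodeCubes (d k : ℕ) : Finset (Cube d) :=
  cubesOfList d (Denumerable.ofNat (List (List ℤ)) k)

/-- The finite-set-valued map with code `k`: the number `k` codes a list of pairs `(Q, R)`, and
the map sends a cube to all cubes listed with it. -/
def decodeMap (d k : ℕ) (a : Cube d) : Finset (Cube d) :=
  cubesOfList d
    (((Denumerable.ofNat (List (List ℤ × List (List ℤ))) k).filter
      fun e => cubeOfList d e.1 = a).flatMap fun e => e.2)

/-- The representation of `ℝ^d`. -/
def PointRep (d : ℕ) (p : ℕ → ℕ) (x : Space d) : Prop :=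
  IsPointName (fun n => decodeCubes d (p n)) x

/-- The representation of `C(ℝ^d, ℝ^d)`. -/
def FunctionRep (d : ℕ) (p : ℕ → ℕ) (f : C(Space d, Space d)) : Prop :=
  IsFunctionName (fun n => decodeMap d (p n)) f

/-- The representation of the closed subsets of `ℝ^d`. -/
def ClosedRep (d : ℕ) (p : ℕ → ℕ) (A : TopologicalSpace.Closeds (Space d)) : Prop :=
  IsClosedName (fun n => decodeCubes d (p n).unpair.1) (fun n => decodeCubes d (p n).unpair.2) A

/-- An instance of the Point Escape Problem. -/
structure Problem : Type where
  d : ℕ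
  f : C(Space d, Space d)
  A : TopologicalSpace.Closeds (Space d)
  x₀ : Space d
  mem : x₀ ∈ A

/-- The parts of a name `p` of an instance: `p 0` is the dimension, and `p (n + 1)` codes the triple
of the `n`-th entries of names of the function, of the closed set and of the point. -/
def functionPart (p : ℕ → ℕ) (n : ℕ) : ℕ := (p (n + 1)).unpair.1

/-- See `functionPart`. -/
def closedPart (p : ℕ → ℕ) (n : ℕ) : ℕ := (p (n + 1)).unpair.2.unpair.1

/-- See `functionPart`. -/
def pointPart (p : ℕ → ℕ) (n : ℕ) : ℕ := (p (n + 1)).unpair.2.unpair.2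

/-- The representation of the space of all instances of the Point Escape Problem. -/
def ProblemRep (p : ℕ → ℕ) (x : Problem) : Prop :=
  p 0 = x.d ∧ FunctionRep x.d (functionPart p) x.f ∧ ClosedRep x.d (closedPart p) x.A ∧
    PointRep x.d (pointPart p) x.x₀

/-- The set of escaping instances. -/
def escapingProblems : Set Problem := {x | Escapes x.f x.A x.x₀}

/-- The Point Escape Algorithm, run on coded input. -/
def pointEscapeOnCode (p : ℕ → ℕ) : Part Answer :=
  pointEscape (d := p 0)
    (fun n => decodeMap (p 0) (functionPart p n))
    (fun n => decodeCubes (p 0) (closedPart p n).unpair.1)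
    (fun n => decodeCubes (p 0) (closedPart p n).unpair.2)
    (fun n => decodeCubes (p 0) (pointPart p n))

/-! ### Oracle computation and decision methods -/

/-- Programs of the oracle machine, in the form of schemes for partial recursive functionals. -/
inductive OracleProgram : Type
  | zero : OracleProgram
  | succ : OracleProgram
  | left : OracleProgram
  | right : OracleProgram
  | oracle : OracleProgram
  | pair : OracleProgram → OracleProgram → OracleProgram
  | comp : OracleProgram → OracleProgram → OracleProgram
  | prec : OracleProgram → OracleProgram → OracleProgram
  | rfind : OracleProgram → OracleProgram

/-- The partial function computed by a program with oracle `Φ`; the clauses are those of Mathlib's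
`Nat.RecursiveIn`. The oracle is part of the input. -/
def OracleProgram.eval (Φ : ℕ → ℕ) : OracleProgram → ℕ → Part ℕ
  | zero => fun _ => Part.some 0
  | succ => fun n => Part.some (n + 1)
  | left => fun n => Part.some n.unpair.1
  | right => fun n => Part.some n.unpair.2
  | oracle => fun n => Part.some (Φ n)
  | pair c e => fun n => (c.eval Φ n).bind fun a => (e.eval Φ n).map fun b => Nat.pair a b
  | comp c e => fun n => (e.eval Φ n).bind (c.eval Φ)
  | prec c e => fun n =>
      Nat.rec (c.eval Φ n.unpair.1)
        (fun y ih => ih.bind fun i => e.eval Φ (Nat.pair n.unpair.1 (Nat.pair y i))) n.unpair.2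
  | rfind c => fun n =>
      Nat.rfind fun m => (c.eval Φ (Nat.pair n m)).map fun k => decide (k = 0)

/-- The result (if any) of running a program on the name `p`. -/
def OracleProgram.run (c : OracleProgram) (p : ℕ → ℕ) : Part ℕ := c.eval p 0

/-- `c` is a (partial) decision method for `S`: whenever it halts on a name of `x`, the output is
`1` if `x ∈ S` and `0` if `x ∉ S`. -/
def IsDecisionMethod {X : Type*} (IsName : (ℕ → ℕ) → X → Prop) (S : Set X) (c : OracleProgram) :
    Prop :=
  ∀ p x, IsName p x → ∀ b ∈ c.run p, (b = 1 ∧ x ∈ S) ∨ (b = 0 ∧ x ∉ S)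

/-- The set of all points on all names of which `c` halts. -/
def haltingSet {X : Type*} (IsName : (ℕ → ℕ) → X → Prop) (c : OracleProgram) : Set X :=
  {x | ∀ p, IsName p x → (c.run p).Dom}

/-- `c` is a complete decision method for `S`: its halting set is the complement of the boundary of
`S`, with respect to the topology of the represented space. -/
def IsCompleteDecisionMethod {X : Type*} (IsName : (ℕ → ℕ) → X → Prop) (S : Set X)
    (c : OracleProgram) : Prop :=
  IsDecisionMethod IsName S c ∧
    haltingSet IsName c = (@frontier X (finalTopology IsName) S)ᶜ

/-- The output that stands for an answer in a decision method for the escaping instances. -/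
def Answer.toNat : Answer → ℕ
  | escapes => 1
  | trapped => 0

end PointEscape

end

open PointEscape

/-!
The proof rests on a topological description of the instances on which the algorithm halts: it
halts iff the point `x₀` escapes or is *robustly trapped*, i.e. some robust invariant `V ⊆ int A`
has `f x₀` in its interior.

*Halting and correctness.* A name of a function converges uniformly on bounded sets
(`IsFunctionName.exists_diam_lt`): cubes on which its values stay large would, by Kőnig's lemma,
include a nested sequence, which the definition of a name excludes. Hence the cubes `F_n^i(X_n)`
shrink to the points of the orbit of `x₀`, so that an escaping orbit is eventually noticed
(`pointEscape_dom_of_escapes`), and they do not leave a robust invariant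
(`pointEscape_dom_of_robust`). Conversely, a stationary set `O_i` of cubes well inside `A` is itself
a robust invariant (`escapes_or_exists_robust`). Every stage terminates, since it only deals with
the finitely many cubes in the box (`stage_dom`).

*Instances on which the algorithm runs forever.* The points that are reached from `x₀` by
`ε`-pseudo-orbits form an open set whose closure is mapped into its interior
(`exists_robust_of_pseudoOrbits`). If `x₀` is not robustly trapped, this set is unbounded or its
closure is not contained in `int A`. In both cases there is a pseudo-orbit that leaves `A`, where
jumps outside of a large ball are free. A shortest pseudo-orbit has no repetitions, so it becomes an
orbit after a small perturbation of `f` on the ball. For `A = ℝ^d` the pseudo-orbit is led far away,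
into a unit ball that is removed from `A`. These perturbations have names that agree with a fixed
name of the given instance up to any prescribed index (`exists_escaping_approximations`), which
is more than convergence in the final topology.

*Computability.* The result of stage `n` only depends on the dimension, on `n` and on the `n`-th
entries of the names. Being well inside a union of cubes means that all neighbouring cubes belong to
it, so a stage is a search with a primitive recursive test on lists of integers
(`rfindOpt_roundCode`, `primrec_roundCode`), and a short program with oracle calls combines the
stages.

*Completeness.* The escaping instances and the robustly trapped ones are recognized by the outputs
of the program, and halting computations use finitely many values of the oracle, so both sets are
open. All other instances are trapped limits of escaping ones, hence boundary points. A decision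
method that halts on such an instance would give the same answer for escaping instances with names
close to a name of it (`haltingSet_subset_of_isDecisionMethod`).
-/

noncomputable section

namespace PointEscape

variable {d : ℕ}

/-! ### Geometry of dyadic cubes -/

theorem mem_body {n : ℕ} {S : Set (Cube d)} {x : Space d} :
    x ∈ body n S ↔ ∃ a ∈ S, x ∈ cube n a := by simp [body]

theorem body_mono {n : ℕ} {S T : Set (Cube d)} (h : S ⊆ T) : body n S ⊆ body n T :=
  biUnion_subset_biUnion_left h

theorem cube_eq_Icc (n : ℕ) (a : Cube d) :
    cube n a = Icc (fun i => (a i : ℝ) / 2 ^ n) (fun i => ((a i : ℝ) + 1) / 2 ^ n) := by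
  ext x
  simp [cube, Pi.le_def, forall_and]

theorem isCompact_cube (n : ℕ) (a : Cube d) : IsCompact (cube n a) := by
  rw [cube_eq_Icc]; exact isCompact_Icc

theorem isCompact_body (n : ℕ) (S : Finset (Cube d)) : IsCompact (body n (S : Set (Cube d))) :=
  S.finite_toSet.isCompact_biUnion fun a _ => isCompact_cube n a

theorem dist_le_of_mem_cube {n : ℕ} {a : Cube d} {x y : Space d} (hx : x ∈ cube n a)
    (hy : y ∈ cube n a) : dist x y ≤ ((2 : ℝ) ^ n)⁻¹ := by
  rw [dist_pi_le_iff (by positivity)]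
  intro i
  have h1 := hx i
  have h2 := hy i
  rw [add_div, one_div] at h1 h2
  rw [Real.dist_eq, abs_le]
  constructor <;> linarith

theorem diam_cube_le (n : ℕ) (a : Cube d) : Metric.diam (cube n a) ≤ ((2 : ℝ) ^ n)⁻¹ :=
  Metric.diam_le_of_forall_dist_le (by positivity) fun _ hx _ hy => dist_le_of_mem_cube hx hy

theorem tendsto_inv_two_pow : Tendsto (fun n : ℕ => ((2 : ℝ) ^ n)⁻¹) atTop (𝓝 0) := by
  simpa using tendsto_pow_atTop_nhds_zero_of_lt_one (r := (2 : ℝ)⁻¹) (by norm_num) (by norm_num)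

/-- A cube of level `n` that contains `x`. -/
def floorCube (n : ℕ) (x : Space d) : Cube d := fun i => ⌊x i * 2 ^ n⌋

theorem mem_cube_iff {n : ℕ} {a : Cube d} {x : Space d} :
    x ∈ cube n a ↔ ∀ i, (a i : ℝ) ≤ x i * 2 ^ n ∧ x i * 2 ^ n ≤ a i + 1 := by
  have h : (0 : ℝ) < 2 ^ n := by positivity
  simp only [cube, mem_ofPred_eq, div_le_iff₀ h, le_div_iff₀ h]

theorem mem_cube_floorCube (n : ℕ) (x : Space d) : x ∈ cube n (floorCube n x) :=
  mem_cube_iff.2 fun _ => ⟨Int.floor_le _, (Int.lt_floor_add_one _).le⟩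

theorem mem_boxCubes_iff {n : ℕ} {a : Cube d} :
    a ∈ boxCubes d n ↔ ∀ i, -(4 : ℤ) ^ n ≤ a i + 1 ∧ a i ≤ 4 ^ n := by
  have h : (0 : ℝ) < 2 ^ n := by positivity
  have h4 : (4 : ℝ) ^ n = 2 ^ n * 2 ^ n := by rw [← mul_pow]; norm_num
  constructor
  · rintro ⟨x, hx, hb⟩ i
    rw [mem_cube_iff] at hx
    have h1 := hx i
    have h2 := hb i
    have h3 : x i * 2 ^ n ≤ 2 ^ n * 2 ^ n := by gcongr; exact h2.2
    have h5 : -2 ^ n * 2 ^ n ≤ x i * 2 ^ n := by gcongr; exact h2.1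
    constructor
    · have : (-(4 : ℝ) ^ n) ≤ a i + 1 := by linarith
      exact_mod_cast this
    · have : (a i : ℝ) ≤ 4 ^ n := by linarith
      exact_mod_cast this
  · intro ha
    have ha' : ∀ i, -(4 : ℝ) ^ n ≤ a i + 1 ∧ (a i : ℝ) ≤ 4 ^ n := fun i => by
      exact_mod_cast ha i
    refine ⟨fun i => max ((a i : ℝ)) (-(4 : ℝ) ^ n) / 2 ^ n, mem_cube_iff.2 fun i => ?_,
      fun i => ?_⟩
    · rw [div_mul_cancel₀ _ h.ne']
      exact ⟨le_max_left _ _, max_le (by linarith) (ha' i).1⟩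
    · constructor
      · rw [le_div_iff₀ h]
        exact le_max_of_le_right (by rw [h4]; linarith)
      · rw [div_le_iff₀ h]
        refine max_le (by rw [← h4]; exact (ha' i).2) ?_
        rw [h4]
        nlinarith

theorem boxCubes_finite (d n : ℕ) : (boxCubes d n).Finite := by
  refine (Set.finite_Icc (fun _ : Fin d => -(4 : ℤ) ^ n - 1) (fun _ => 4 ^ n)).subset fun a ha => ?_
  rw [mem_boxCubes_iff] at ha
  exact ⟨fun i => by simpa using (ha i).1, fun i => (ha i).2⟩

theorem box_mono {m n : ℕ} (h : m ≤ n) : box d m ⊆ box d n := fun x hx i => by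
  have h2 : (2 : ℝ) ^ m ≤ 2 ^ n := pow_le_pow_right₀ (by norm_num) h
  exact ⟨by linarith [(hx i).1], by linarith [(hx i).2]⟩

/-- Every bounded set is contained in the box of any sufficiently large level. -/
theorem exists_subset_box {K : Set (Space d)} (hK : Bornology.IsBounded K) :
    ∃ m, ∀ n, m ≤ n → K ⊆ box d n := by
  obtain ⟨R, hR⟩ := hK.subset_closedBall 0
  obtain ⟨m, hm⟩ := pow_unbounded_of_one_lt R (one_lt_two : (1 : ℝ) < 2)
  refine ⟨m, fun n hn => (show K ⊆ box d m from fun x hx i => ?_).trans (box_mono hn)⟩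
  have h1 : ‖x‖ ≤ R := by simpa using hR hx
  have h2 := norm_le_pi_norm x i
  rw [Real.norm_eq_abs] at h2
  exact abs_le.1 (by linarith)

/-- The cube of level `n` that contains the given cube of level `n + 1`. -/
def parent (a : Cube d) : Cube d := fun i => a i / 2

theorem cube_subset_parent (n : ℕ) (a : Cube d) : cube (n + 1) a ⊆ cube n (parent a) := by
  intro x hx
  rw [mem_cube_iff] at hx ⊢
  intro i
  have h1 := hx i
  rw [pow_succ] at h1
  have h2 : 2 * (a i / 2) ≤ a i := by omega
  have h3 : a i + 1 ≤ 2 * (a i / 2) + 2 := by omega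
  have h2' : (2 : ℝ) * ((a i / 2 : ℤ) : ℝ) ≤ a i := by exact_mod_cast h2
  have h3' : (a i : ℝ) + 1 ≤ 2 * ((a i / 2 : ℤ) : ℝ) + 2 := by exact_mod_cast h3
  simp only [parent]
  constructor <;> linarith

theorem cube_nonempty (n : ℕ) (a : Cube d) : (cube n a).Nonempty :=
  ⟨fun i => (a i : ℝ) / 2 ^ n, mem_cube_iff.2 fun i => by
    rw [div_mul_cancel₀ _ (by positivity)]; simp⟩

/-- The cubes inside a cube that meets the box of level `n` lie in the box of level `n + 1`. -/
theorem cube_subset_box_succ {n : ℕ} {a : Cube d} (ha : a ∈ boxCubes d n) :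
    cube n a ⊆ box d (n + 1) := by
  obtain ⟨y, hy, hb⟩ := ha
  intro x hx i
  have h1 := dist_le_of_mem_cube hx hy
  have h2 := (dist_le_pi_dist x y i).trans h1
  rw [Real.dist_eq, abs_le] at h2
  have h3 : ((2 : ℝ) ^ n)⁻¹ ≤ 1 := inv_le_one_of_one_le₀ (one_le_pow₀ (by norm_num))
  have h4 : (1 : ℝ) ≤ 2 ^ n := one_le_pow₀ (by norm_num)
  have h5 := hb i
  rw [pow_succ]
  constructor <;> linarith

theorem mem_boxCubes_of_subset {n : ℕ} {a b : Cube d} (ha : a ∈ boxCubes d n)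
    (h : cube (n + 1) b ⊆ cube n a) : b ∈ boxCubes d (n + 1) := by
  obtain ⟨x, hx⟩ := cube_nonempty (n + 1) b
  exact ⟨x, hx, cube_subset_box_succ ha (h hx)⟩

/-- Two cubes meet iff their indices differ by at most one in each coordinate. -/
theorem cube_inter_nonempty_iff {n : ℕ} {a b : Cube d} :
    (cube n a ∩ cube n b).Nonempty ↔ ∀ i, |b i - a i| ≤ 1 := by
  constructor
  · rintro ⟨x, hxa, hxb⟩ i
    rw [mem_cube_iff] at hxa hxb
    have h1 : (a i : ℝ) ≤ b i + 1 := (hxa i).1.trans (hxb i).2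
    have h2 : (b i : ℝ) ≤ a i + 1 := (hxb i).1.trans (hxa i).2
    have h1' : a i ≤ b i + 1 := by exact_mod_cast h1
    have h2' : b i ≤ a i + 1 := by exact_mod_cast h2
    rw [abs_le]; constructor <;> linarith
  · intro h
    refine ⟨fun i => ((max (a i) (b i) : ℤ) : ℝ) / 2 ^ n, mem_cube_iff.2 fun i => ?_,
      mem_cube_iff.2 fun i => ?_⟩ <;>
    · rw [div_mul_cancel₀ _ (by positivity)]
      have := abs_le.1 (h i)
      constructor
      · exact_mod_cast (by simp)
      · exact_mod_cast (by omega)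

theorem cube_subset_closure_open (n : ℕ) (a : Cube d) :
    cube n a ⊆ closure {x | ∀ i, (a i : ℝ) / 2 ^ n < x i ∧ x i < ((a i : ℝ) + 1) / 2 ^ n} := by
  have h : {x : Space d | ∀ i, (a i : ℝ) / 2 ^ n < x i ∧ x i < ((a i : ℝ) + 1) / 2 ^ n}
      = Set.pi univ fun i => Ioo ((a i : ℝ) / 2 ^ n) (((a i : ℝ) + 1) / 2 ^ n) := by
    ext x; simp [Set.mem_pi]
  rw [h, closure_pi_set]
  intro x hx i _
  beta_reduce
  rw [closure_Ioo (by
    have : (0 : ℝ) < 2 ^ n := by positivity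
    exact (by rw [div_lt_div_iff_of_pos_right this]; linarith : (_ : ℝ) < _).ne)]
  exact hx i

/-- A cube is well inside a union of cubes iff the union includes all its neighbours. -/
theorem wellInside_cube_body_iff {n : ℕ} {a : Cube d} {S : Set (Cube d)} :
    WellInside (cube n a) (body n S) ↔ ∀ b : Cube d, (∀ i, |b i - a i| ≤ 1) → b ∈ S := by
  have h2 : (0 : ℝ) < 2 ^ n := by positivity
  rw [WellInside, (isCompact_cube n a).isClosed.closure_eq]
  constructor
  · intro h b hb
    -- the interior of `cube n b` comes close to a common point `x`, and meets no other cube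
    obtain ⟨x, hxa, hxb⟩ := cube_inter_nonempty_iff.2 hb
    obtain ⟨y, hyU, hyb⟩ := mem_closure_iff.1 (cube_subset_closure_open n b hxb) _
      isOpen_interior (h hxa)
    obtain ⟨e, he, hye⟩ := mem_body.1 (interior_subset hyU)
    have : e = b := by
      funext i
      have h1 := hyb i
      rw [div_lt_iff₀ h2, lt_div_iff₀ h2] at h1
      have h3 := mem_cube_iff.1 hye i
      have h4 : (b i : ℝ) < e i + 1 := by linarith
      have h5 : (e i : ℝ) < b i + 1 := by linarith
      have h4' : b i < e i + 1 := by exact_mod_cast h4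
      have h5' : e i < b i + 1 := by exact_mod_cast h5
      omega
    rwa [← this]
  · intro h x hx
    refine mem_interior.2 ⟨Set.pi univ fun i => Ioo (((a i : ℝ) - 1) / 2 ^ n)
      (((a i : ℝ) + 2) / 2 ^ n), fun y hy => ?_, isOpen_set_pi finite_univ fun i _ => isOpen_Ioo,
      fun i _ => ?_⟩
    · refine mem_body.2 ⟨floorCube n y, h _ fun i => ?_, mem_cube_floorCube n y⟩
      have h1 := hy i (mem_univ i)
      rw [mem_Ioo, div_lt_iff₀ h2, lt_div_iff₀ h2] at h1
      have h3 : a i - 1 ≤ ⌊y i * 2 ^ n⌋ := Int.le_floor.2 (by push_cast; linarith)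
      have h4 : ⌊y i * 2 ^ n⌋ < a i + 2 := Int.floor_lt.2 (by push_cast; linarith)
      simp only [floorCube]
      rw [abs_le]; constructor <;> linarith
    · have h1 := hx i
      constructor
      · refine lt_of_lt_of_le ?_ h1.1
        rw [div_lt_div_iff_of_pos_right h2]; linarith
      · refine lt_of_le_of_lt h1.2 ?_
        rw [div_lt_div_iff_of_pos_right h2]; linarith

theorem wellInside_body_iff {n : ℕ} {S : Finset (Cube d)} {B : Set (Space d)} :
    WellInside (body n (S : Set (Cube d))) B ↔ ∀ a ∈ S, WellInside (cube n a) B := by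
  rw [WellInside, (isCompact_body n S).isClosed.closure_eq, body, iUnion₂_subset_iff]
  simp only [WellInside, (isCompact_cube n _).isClosed.closure_eq, Finset.mem_coe]

/-! ### Uniform convergence of function names -/

/-- Kőnig's lemma for dyadic cubes: a property that passes from cubes to their parents and holds for
some cube, taken from a finite set, at every level holds along a nested sequence of cubes. -/
theorem exists_nested_seq (B : ℕ → Set (Cube d)) (m : ℕ) (hfin : ∀ n, m ≤ n → (B n).Finite)
    (hpar : ∀ n, m ≤ n → ∀ a ∈ B (n + 1), parent a ∈ B n)
    (hne : ∀ N, ∃ n, N ≤ n ∧ (B n).Nonempty) :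
    ∃ Q : ℕ → Cube d, (∀ n, m ≤ n → Q n ∈ B n) ∧ ∀ n, m ≤ n → parent (Q (n + 1)) = Q n := by
  have hdown : ∀ k n, m ≤ n → ∀ a ∈ B (n + k), parent^[k] a ∈ B n := by
    intro k
    induction k with
    | zero => intro n _ a ha; exact ha
    | succ k ih =>
      intro n hn a ha
      rw [Function.iterate_succ_apply]
      exact ih n hn _ (hpar (n + k) (by omega) a ha)
  have hne' : ∀ n, m ≤ n → (B n).Nonempty := by
    intro n hn
    obtain ⟨k, hk, a, ha⟩ := hne n
    obtain ⟨j, rfl⟩ := Nat.exists_eq_add_of_le hk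
    exact ⟨_, hdown j n hn a ha⟩
  choose! b hb using hne'
  -- `Q n` is the ancestor of `b k` at level `n`, for most `k` in the sense of an ultrafilter
  have hex : ∀ n, ∃ a, m ≤ n → a ∈ B n ∧
      ∀ᶠ k in (hyperfilter ℕ : Filter ℕ), parent^[k - n] (b k) = a := by
    intro n
    by_cases hn : m ≤ n
    · have h1 : ∀ᶠ k in (hyperfilter ℕ : Filter ℕ), ∃ a ∈ B n, parent^[k - n] (b k) = a := by
        refine Nat.hyperfilter_le_atTop ((eventually_ge_atTop n).mono fun k hk => ⟨_, ?_, rfl⟩)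
        refine hdown _ n hn _ ?_
        rw [Nat.add_sub_cancel' hk]
        exact hb k (hn.trans hk)
      obtain ⟨a, ha, h2⟩ := (Ultrafilter.eventually_exists_mem_iff (hfin n hn)).1 h1
      exact ⟨a, fun _ => ⟨ha, h2⟩⟩
    · exact ⟨0, fun h => absurd h hn⟩
  choose Q hQ using hex
  refine ⟨Q, fun n hn => (hQ n hn).1, fun n hn => ?_⟩
  have h1 := (hQ n hn).2
  have h2 := (hQ (n + 1) (by omega)).2
  have h3 : ∀ᶠ k in (hyperfilter ℕ : Filter ℕ), n + 1 ≤ k :=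
    Nat.hyperfilter_le_atTop (eventually_ge_atTop _)
  obtain ⟨k, h1, h2, h3⟩ := (h1.and (h2.and h3)).exists
  rw [← h1, ← h2, ← Function.iterate_succ_apply' parent]
  congr 2
  omega

/-- A function name converges uniformly on compact sets. -/
theorem IsFunctionName.exists_diam_lt {F : ℕ → Cube d → Finset (Cube d)} {f : C(Space d, Space d)}
    (hF : IsFunctionName F f) {K : Set (Space d)} (hK : Bornology.IsBounded K) {ε : ℝ}
    (hε : 0 < ε) :
    ∃ N, ∀ n, N ≤ n → ∀ a : Cube d, (cube n a ∩ K).Nonempty →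
      Metric.diam (body n (F n a : Set (Cube d))) < ε := by
  by_contra! hcon
  obtain ⟨m, hm⟩ := exists_subset_box hK
  -- if a cube is bad, then so is its parent, by the monotonicity of names
  let B : ℕ → Set (Cube d) := fun n =>
    {a | (cube n a ∩ K).Nonempty ∧ ε ≤ Metric.diam (body n (F n a : Set (Cube d)))}
  have hbox : ∀ n, m ≤ n → B n ⊆ boxCubes d n := fun n hn a ha =>
    ha.1.mono (inter_subset_inter_right _ (hm n hn))
  obtain ⟨Q, hQ, hpar⟩ := exists_nested_seq B m
    (fun n hn => (boxCubes_finite d n).subset (hbox n hn))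
    (fun n hn a ha => by
      have h1 : (cube n (parent a) ∩ K).Nonempty :=
        ha.1.mono (inter_subset_inter_left _ (cube_subset_parent n a))
      refine ⟨h1, ha.2.trans (Metric.diam_mono ?_ (isCompact_body _ _).isBounded)⟩
      exact hF.antitone n _ (h1.mono (inter_subset_inter_right _ (hm n hn))) _
        (hbox _ (by omega) ha) (cube_subset_parent n a))
    (fun N => by
      obtain ⟨n, hn, a, ha⟩ := hcon N
      exact ⟨n, hn, a, ha⟩)
  have hlim := hF.diam_tendsto m Q (fun n hn => hbox n hn (hQ n hn))
    (fun n hn => by rw [← hpar n hn]; exact cube_subset_parent n _)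
    (squeeze_zero (fun _ => Metric.diam_nonneg) (fun n => diam_cube_le n _) tendsto_inv_two_pow)
  obtain ⟨n, h1, h2⟩ := ((hlim.eventually (gt_mem_nhds hε)).and (eventually_ge_atTop m)).exists
  exact absurd (hQ n h2).2 (not_le.2 h1)

/-- Uniformly on bounded sets, the value of a function name on a cube is close to the values of the
function on the cube. -/
theorem IsFunctionName.exists_dist_lt {F : ℕ → Cube d → Finset (Cube d)} {f : C(Space d, Space d)}
    (hF : IsFunctionName F f) {K : Set (Space d)} (hK : Bornology.IsBounded K) {ε : ℝ}
    (hε : 0 < ε) :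
    ∃ N, ∀ n, N ≤ n → ∀ a : Cube d, (cube n a ∩ K).Nonempty → ∀ x ∈ cube n a,
      ∀ y ∈ body n (F n a : Set (Cube d)), dist y (f x) < ε := by
  obtain ⟨N, hN⟩ := hF.exists_diam_lt hK hε
  obtain ⟨m, hm⟩ := exists_subset_box hK
  refine ⟨max N m, fun n hn a ha x hx y hy => ?_⟩
  have hb : a ∈ boxCubes d n := ha.mono (inter_subset_inter_right _ (hm n (by omega)))
  exact (Metric.dist_le_diam_of_mem (isCompact_body _ _).isBounded hy
    (interior_subset (hF.image_subset n a hb (mem_image_of_mem f hx)))).trans_lt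
      (hN n (by omega) a ha)

/-! ### Stages of the algorithm -/

theorem mem_rfindOpt_iff {α : Type*} {f : ℕ → Option α} {a : α} :
    a ∈ Nat.rfindOpt f ↔ ∃ j, f j = some a ∧ ∀ i < j, f i = none := by
  constructor
  · intro h
    obtain ⟨j, h1, h2⟩ := Part.mem_bind_iff.1 h
    refine ⟨j, by simpa using h2, fun i hi => ?_⟩
    have h3 := (Nat.mem_rfind.1 h1).2 hi
    simpa using h3
  · rintro ⟨j, h1, h2⟩
    refine Part.mem_bind_iff.2 ⟨j, Nat.mem_rfind.2 ⟨by simp [h1], fun {i} hi => ?_⟩, by simp [h1]⟩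
    simp [h2 i hi]

/-- The variables of the loop in stage `n` after `j` rounds. -/
def loopState (n : ℕ) (F : Cube d → Finset (Cube d)) (E X : Finset (Cube d)) (j : ℕ) :
    LoopState d :=
  (nextState n F E)^[j] (initState n F E X)

section Loop

variable {n : ℕ} {F : Cube d → Finset (Cube d)} {I E X : Finset (Cube d)}

theorem loopState_succ (j : ℕ) :
    loopState n F E X (j + 1) = nextState n F E (loopState n F E X j) :=
  Function.iterate_succ_apply' _ _ _

theorem setImage_mono {S T : Finset (Cube d)} (h : S ⊆ T) : setImage F S ⊆ setImage F T :=
  Finset.biUnion_subset_biUnion_of_subset_left F h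

theorem notExcluded_subset (S : Finset (Cube d)) : notExcluded n E S ⊆ S :=
  by classical exact Finset.filter_subset _ _

theorem mem_notExcluded {S : Finset (Cube d)} {a : Cube d} :
    a ∈ notExcluded n E S ↔ a ∈ S ∧ ¬ WellInside (cube n a) (body n (E : Set (Cube d))) := by
  simp [notExcluded]

theorem loopState_Q (j : ℕ) : (loopState n F E X j).Q = (setImage F)^[j + 1] X := by
  induction j with
  | zero => rfl
  | succ j ih =>
    rw [loopState_succ, Function.iterate_succ_apply', ← ih]
    rfl

theorem loopState_P_subset (j : ℕ) : (loopState n F E X j).P ⊆ (loopState n F E X j).Q := by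
  induction j with
  | zero => exact notExcluded_subset _
  | succ j ih =>
    rw [loopState_succ]
    exact (notExcluded_subset _).trans (setImage_mono ih)

theorem loopState_P_eq_empty {j : ℕ} (h : (loopState n F E X j).P = ∅) {k : ℕ} (hk : j ≤ k) :
    (loopState n F E X k).P = ∅ := by
  induction k, hk using Nat.le_induction with
  | base => exact h
  | succ k _ ih => rw [loopState_succ, nextState, ih]; simp [setImage, notExcluded]

theorem loopState_O_succ (j : ℕ) : (loopState n F E X (j + 1)).O =
    (loopState n F E X j).O ∪ (loopState n F E X (j + 1)).Q := by
  rw [loopState_succ]; rfl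

theorem mem_loopState_O {j : ℕ} {a : Cube d} :
    a ∈ (loopState n F E X j).O ↔ ∃ i ≤ j, a ∈ (loopState n F E X i).Q := by
  induction j with
  | zero => simp only [Nat.le_zero, exists_eq_left]; rfl
  | succ j ih =>
    rw [loopState_O_succ, Finset.mem_union, ih]
    constructor
    · rintro (⟨i, hi, h⟩ | h)
      · exact ⟨i, by omega, h⟩
      · exact ⟨_, le_rfl, h⟩
    · rintro ⟨i, hi, h⟩
      rcases Nat.le_succ_iff.1 hi with hi | rfl
      · exact Or.inl ⟨i, hi, h⟩
      · exact Or.inr h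

theorem setImage_loopState_O (j : ℕ) :
    setImage F (loopState n F E X j).O ⊆ (loopState n F E X (j + 1)).O := by
  intro b hb
  obtain ⟨a, ha, hab⟩ := Finset.mem_biUnion.1 hb
  obtain ⟨i, hi, h⟩ := mem_loopState_O.1 ha
  refine mem_loopState_O.2 ⟨i + 1, by omega, ?_⟩
  rw [loopState_succ]
  exact Finset.mem_biUnion.2 ⟨a, h, hab⟩

theorem stage_eq : stage n F I E X =
    open Classical in
    if (body n (X : Set (Cube d)) ∩ body n (boxCubes d n)ᶜ).Nonempty then Part.some none
    else if ((setImage F X : Set (Cube d)) ∩ (boxCubes d n)ᶜ).Nonempty then Part.some none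
    else Nat.rfindOpt fun j =>
      loopTests n I (loopState n F E X j) (loopState n F E X (j + 1)) := rfl

theorem loopTests_eq_none {s t : LoopState d} (h : loopTests n I s t = none) :
    (t.Q : Set (Cube d)) ⊆ boxCubes d n ∧ s.O ≠ t.O := by
  unfold loopTests at h
  split_ifs at h with h1 h2 h3
  exact ⟨fun a ha => by_contra fun hn => h2 ⟨a, ha, hn⟩, h3⟩

/-- Every stage terminates: as long as the loop continues, the sets `O_i` grow strictly inside the
finite set of cubes in the box. -/
theorem stage_dom : (stage n F I E X).Dom := by
  rw [stage_eq]
  split_ifs with h1 h2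
  · trivial
  · trivial
  rw [Nat.rfindOpt_dom]
  by_contra! hcon
  have hnone : ∀ j, loopTests n I (loopState n F E X j) (loopState n F E X (j + 1)) = none :=
    fun j => Option.eq_none_iff_forall_not_mem.2 (hcon j)
  have hsub : ∀ j, ((loopState n F E X j).O : Set (Cube d)) ⊆ boxCubes d n := by
    intro j a ha
    obtain ⟨i, -, hi⟩ := mem_loopState_O.1 (Finset.mem_coe.1 ha)
    cases i with
    | zero => exact by_contra fun hn => h2 ⟨a, hi, hn⟩
    | succ i => exact (loopTests_eq_none (hnone i)).1 hi
  have hcard : StrictMono fun j => (loopState n F E X j).O.card := by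
    refine strictMono_nat_of_lt_succ fun j => Finset.card_lt_card
      (Finset.ssubset_iff_subset_ne.2 ⟨?_, (loopTests_eq_none (hnone j)).2⟩)
    rw [loopState_O_succ]
    exact Finset.subset_union_left
  have h3 := hcard.le_apply (x := (boxCubes_finite d n).toFinset.card + 1)
  have h4 := Finset.card_le_card (s := (loopState n F E X _).O)
    (fun a ha => (boxCubes_finite d n).mem_toFinset.2
      (hsub ((boxCubes_finite d n).toFinset.card + 1) ha))
  omega

/-- What an answer of a stage means: up to the round in which the stage stops, all cubes lie in
the box. -/
theorem some_mem_stage {r : Answer} (h : some r ∈ stage n F I E X) :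
    (X : Set (Cube d)) ⊆ boxCubes d n ∧ ∃ j,
      (∀ i ≤ j, ((loopState n F E X i).Q : Set (Cube d)) ⊆ boxCubes d n) ∧
      ((r = Answer.escapes ∧ (loopState n F E X (j + 1)).P = ∅) ∨
        (r = Answer.trapped ∧ (loopState n F E X j).O = (loopState n F E X (j + 1)).O ∧
          WellInside (body n ((loopState n F E X j).O : Set (Cube d)))
            (body n (I : Set (Cube d))))) := by
  rw [stage_eq] at h
  split_ifs at h with h1 h2
  · simp at h
  · simp at h
  obtain ⟨j, hj, hlt⟩ := mem_rfindOpt_iff.1 h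
  refine ⟨fun a ha => by_contra fun hn => h1 ?_, j, fun i hi => ?_, ?_⟩
  · obtain ⟨x, hx⟩ := cube_nonempty n a
    exact ⟨x, mem_body.2 ⟨a, ha, hx⟩, mem_body.2 ⟨a, hn, hx⟩⟩
  · cases i with
    | zero => exact fun a ha => by_contra fun hn => h2 ⟨a, ha, hn⟩
    | succ i => exact (loopTests_eq_none (hlt i (by omega))).1
  · unfold loopTests at hj
    split_ifs at hj with h3 h4 h5 h6
    · exact Or.inl ⟨by simpa using hj.symm, h3⟩
    · simp at hj
    · exact Or.inr ⟨by simpa using hj.symm, h5, h6⟩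
    · simp at hj

/-- What the result `Unknown` of a stage means. -/
theorem none_mem_stage (h : none ∈ stage n F I E X) :
    (body n (X : Set (Cube d)) ∩ body n (boxCubes d n)ᶜ).Nonempty ∨
    ¬ (((loopState n F E X 0).Q : Set (Cube d)) ⊆ boxCubes d n) ∨
    ∃ j, (loopState n F E X (j + 1)).P ≠ ∅ ∧
      (¬ (((loopState n F E X (j + 1)).Q : Set (Cube d)) ⊆ boxCubes d n) ∨
        ((loopState n F E X j).O = (loopState n F E X (j + 1)).O ∧
          ¬ WellInside (body n ((loopState n F E X j).O : Set (Cube d)))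
            (body n (I : Set (Cube d))))) := by
  rw [stage_eq] at h
  split_ifs at h with h1 h2
  · exact Or.inl h1
  · obtain ⟨a, ha, hn⟩ := h2
    exact Or.inr (Or.inl fun hs => hn (hs ha))
  obtain ⟨j, hj, -⟩ := mem_rfindOpt_iff.1 h
  refine Or.inr (Or.inr ⟨j, ?_⟩)
  unfold loopTests at hj
  split_ifs at hj with h3 h4 h5 h6
  · simp at hj
  · obtain ⟨a, ha, hn⟩ := h4
    exact ⟨h3, Or.inl fun hs => hn (hs ha)⟩
  · simp at hj
  · exact ⟨h3, Or.inr ⟨h5, h6⟩⟩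

end Loop

theorem mem_pointEscape {F : ℕ → Cube d → Finset (Cube d)} {I E X : ℕ → Finset (Cube d)}
    {r : Answer} (h : r ∈ pointEscape F I E X) :
    ∃ n, some r ∈ stage n (F n) (I n) (E n) (X n) := by
  obtain ⟨n, -, h⟩ := Part.mem_bind_iff.1 h
  obtain ⟨o, ho, hr⟩ := Part.mem_bind_iff.1 h
  rw [Part.mem_ofOption, Option.mem_def] at hr
  exact ⟨n, hr ▸ ho⟩

/-- Since all stages terminate, the algorithm halts as soon as some stage returns an answer. -/
theorem pointEscape_dom {F : ℕ → Cube d → Finset (Cube d)} {I E X : ℕ → Finset (Cube d)}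
    {n : ℕ} (h : none ∉ stage n (F n) (I n) (E n) (X n)) : (pointEscape F I E X).Dom := by
  have hsome : ∀ {n}, none ∉ stage n (F n) (I n) (E n) (X n) →
      ∃ r, some r ∈ stage n (F n) (I n) (E n) (X n) := by
    intro n h
    have h1 := Part.get_mem (stage_dom (n := n) (F := F n) (I := I n) (E := E n) (X := X n))
    cases h2 : (stage n (F n) (I n) (E n) (X n)).get stage_dom with
    | none => rw [h2] at h1; exact absurd h1 h
    | some r => rw [h2] at h1; exact ⟨r, h1⟩
  have hd : (Nat.rfind fun n =>
      (stage n (F n) (I n) (E n) (X n)).map Option.isSome).Dom := by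
    obtain ⟨r, hr⟩ := hsome h
    exact Nat.rfind_dom.2 ⟨n, (Part.mem_map_iff _).2 ⟨_, hr, rfl⟩, fun {_} _ => stage_dom⟩
  have hm := Part.get_mem hd
  obtain ⟨o, ho, ho'⟩ := (Part.mem_map_iff _).1 (Nat.rfind_spec hm)
  obtain ⟨r, rfl⟩ := Option.isSome_iff_exists.1 ho'
  exact Part.dom_iff_mem.2 ⟨r, Part.mem_bind_iff.2 ⟨_, hm, Part.mem_bind_iff.2 ⟨_, ho, by simp⟩⟩⟩

/-! ### Correctness of the answers -/

theorem trapped_of_isRobustInvariant {f : C(Space d, Space d)}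
    {A : TopologicalSpace.Closeds (Space d)} {x₀ : Space d} (hx : x₀ ∈ A) {V : Set (Space d)}
    (hV : IsRobustInvariant f V) (hVA : V ⊆ interior (A : Set (Space d)))
    (hfx : f x₀ ∈ interior V) : Trapped f A x₀ := by
  have h : ∀ n : ℕ, f^[n + 1] x₀ ∈ V := by
    intro n
    induction n with
    | zero => exact interior_subset hfx
    | succ n ih =>
      rw [Function.iterate_succ_apply']
      exact interior_subset (hV.2 (mem_image_of_mem f ih))
  intro n
  cases n with
  | zero => exact hx
  | succ n => exact interior_subset (hVA (h n))

section

variable {f : C(Space d, Space d)} {A : TopologicalSpace.Closeds (Space d)} {x₀ : Space d}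
  {F : ℕ → Cube d → Finset (Cube d)} {I E X : ℕ → Finset (Cube d)}

/-- The cubes `F_n^i(X_n)` contain the `i`-th point of the orbit, as long as the preceding ones
lie in the box. -/
theorem iterate_mem_body (hF : IsFunctionName F f) (hX : IsPointName X x₀) {n i : ℕ}
    (h : ∀ l < i, (((setImage (F n))^[l] (X n) : Finset (Cube d)) : Set (Cube d)) ⊆ boxCubes d n) :
    f^[i] x₀ ∈ body n (((setImage (F n))^[i] (X n) : Finset (Cube d)) : Set (Cube d)) := by
  induction i with
  | zero => exact interior_subset (hX.mem_interior n)
  | succ i ih =>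
    obtain ⟨a, ha, hxa⟩ := mem_body.1 (ih fun l hl => h l (by omega))
    rw [Function.iterate_succ_apply', Function.iterate_succ_apply']
    refine body_mono ?_ (interior_subset (hF.image_subset n a (h i (by omega) ha)
      (mem_image_of_mem f hxa)))
    exact Finset.coe_subset.2 (Finset.subset_biUnion_of_mem (F n) ha)

/-- The answers are correct. If the answer is `Trapped`, then the union of the cubes in the
stationary set `O_i` is a robust invariant. -/
theorem escapes_or_exists_robust (hF : IsFunctionName F f) (hA : IsClosedName I E A)
    (hX : IsPointName X x₀) {n : ℕ} {r : Answer} (h : some r ∈ stage n (F n) (I n) (E n) (X n)) :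
    (r = Answer.escapes ∧ Escapes f A x₀) ∨ (r = Answer.trapped ∧ ∃ V : Set (Space d),
      IsRobustInvariant f V ∧ V ⊆ interior (A : Set (Space d)) ∧ f x₀ ∈ interior V) := by
  obtain ⟨hXb, j, hQ, ⟨rfl, hP⟩ | ⟨rfl, hO, hI⟩⟩ := some_mem_stage h
  · refine Or.inl ⟨rfl, ?_⟩
    by_contra hesc
    have htr : ∀ k, f^[k] x₀ ∈ A := by simpa [Escapes] using hesc
    have hE : ∀ k a, f^[k] x₀ ∈ cube n a →
        ¬ WellInside (cube n a) (body n (E n : Set (Cube d))) := fun k a hk hw =>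
      interior_subset (hA.outer_wellInside n (subset_closure
        (interior_subset (hw (subset_closure hk))))) (htr k)
    -- a trapped orbit would always stay in the cubes that are not excluded
    have hmem : ∀ i ≤ j + 1,
        f^[i + 1] x₀ ∈ body n ((loopState n (F n) (E n) (X n) i).P : Set (Cube d)) := by
      intro i
      induction i with
      | zero =>
        intro _
        obtain ⟨a, ha, hxa⟩ := mem_body.1 (iterate_mem_body hF hX (n := n) (i := 1)
          (fun l hl => by obtain rfl : l = 0 := by omega
                          exact hXb))
        exact mem_body.2 ⟨a, mem_notExcluded.2 ⟨ha, hE _ a hxa⟩, hxa⟩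
      | succ i ih =>
        intro hi
        obtain ⟨a, ha, hxa⟩ := mem_body.1 (ih (by omega))
        have hab := hQ i (by omega) (loopState_P_subset i ha)
        obtain ⟨b, hb, hxb⟩ := mem_body.1 (interior_subset (hF.image_subset n a hab
          (mem_image_of_mem f hxa)))
        rw [← Function.iterate_succ_apply' f] at hxb
        refine mem_body.2 ⟨b, ?_, hxb⟩
        rw [loopState_succ]
        exact mem_notExcluded.2 ⟨Finset.mem_biUnion.2 ⟨a, ha, hb⟩, hE _ b hxb⟩
    have := hmem (j + 1) le_rfl
    rw [hP] at this
    simp [body] at this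
  · refine Or.inr ⟨rfl, body n ((loopState n (F n) (E n) (X n) j).O : Set (Cube d)),
      ⟨isCompact_body _ _, ?_⟩, ?_, ?_⟩
    · rintro _ ⟨x, hx, rfl⟩
      obtain ⟨a, ha, hxa⟩ := mem_body.1 hx
      obtain ⟨i, hi, hai⟩ := mem_loopState_O.1 ha
      refine interior_mono (body_mono ?_) (hF.image_subset n a (hQ i hi hai)
        (mem_image_of_mem f hxa))
      rw [Finset.coe_subset, hO]
      exact (Finset.subset_biUnion_of_mem (F n) ha).trans (setImage_loopState_O j)
    · exact (subset_closure.trans hI).trans (interior_subset.trans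
        (subset_closure.trans (hA.inner_wellInside n)))
    · obtain ⟨a, ha, hxa⟩ := mem_body.1 (interior_subset (hX.mem_interior n))
      refine interior_mono (body_mono ?_) (hF.image_subset n a (hXb ha)
        (mem_image_of_mem f hxa))
      exact Finset.coe_subset.2 fun b hb => mem_loopState_O.2 ⟨0, Nat.zero_le _,
        Finset.mem_biUnion.2 ⟨a, ha, hb⟩⟩

/-! ### Halting of the algorithm -/

/-- For large `n` the cubes `F_n^i(X_n)` are close to the `i`-th point of the orbit. -/
theorem exists_body_iterate_close (hF : IsFunctionName F f) (hX : IsPointName X x₀) (i : ℕ)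
    {ε : ℝ} (hε : 0 < ε) : ∃ N, ∀ n, N ≤ n → ∀ y ∈ body n
      (((setImage (F n))^[i] (X n) : Finset (Cube d)) : Set (Cube d)), dist y (f^[i] x₀) < ε := by
  induction i generalizing ε with
  | zero =>
    obtain ⟨N, hN⟩ := eventually_atTop.1 (hX.diam_tendsto.eventually (gt_mem_nhds hε))
    exact ⟨N, fun n hn y hy => (Metric.dist_le_diam_of_mem (isCompact_body _ _).isBounded hy
      (interior_subset (hX.mem_interior n))).trans_lt (hN n hn)⟩
  | succ i ih =>
    obtain ⟨δ, hδ, hfδ⟩ := Metric.continuousAt_iff.1 (f.continuous.continuousAt (x := f^[i] x₀))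
      (ε / 2) (half_pos hε)
    obtain ⟨N₁, h₁⟩ := ih (ε := min δ 1) (by positivity)
    obtain ⟨N₂, h₂⟩ := hF.exists_dist_lt (Metric.isBounded_ball (x := f^[i] x₀) (r := 1))
      (half_pos hε)
    refine ⟨max N₁ N₂, fun n hn y hy => ?_⟩
    rw [Function.iterate_succ_apply'] at hy
    obtain ⟨b, hb, hyb⟩ := mem_body.1 hy
    obtain ⟨a, ha, hab⟩ := Finset.mem_biUnion.1 (Finset.mem_coe.1 hb)
    obtain ⟨z, hz⟩ := cube_nonempty n a
    have h3 := h₁ n (by omega) z (mem_body.2 ⟨a, ha, hz⟩)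
    have h4 := h₂ n (by omega) a ⟨z, hz, h3.trans_le (min_le_right _ _)⟩ z hz y
      (mem_body.2 ⟨b, hab, hyb⟩)
    have h5 := hfδ (h3.trans_le (min_le_left _ _))
    rw [Function.iterate_succ_apply']
    linarith [dist_triangle y (f z) (f (f^[i] x₀))]

theorem subset_boxCubes_of_body_subset {n : ℕ} {S : Finset (Cube d)}
    (h : body n (S : Set (Cube d)) ⊆ box d n) : (S : Set (Cube d)) ⊆ boxCubes d n := fun a ha => by
  obtain ⟨x, hx⟩ := cube_nonempty n a
  exact ⟨x, hx, h (mem_body.2 ⟨a, ha, hx⟩)⟩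

theorem exists_iterate_subset_box (hF : IsFunctionName F f) (hX : IsPointName X x₀) (i : ℕ) :
    ∃ N, ∀ n, N ≤ n →
      body n (((setImage (F n))^[i] (X n) : Finset (Cube d)) : Set (Cube d)) ⊆ box d n := by
  obtain ⟨N, hN⟩ := exists_body_iterate_close hF hX i one_pos
  obtain ⟨m, hm⟩ := exists_subset_box (Metric.isBounded_ball (x := f^[i] x₀) (r := 1))
  exact ⟨max N m, fun n hn y hy => hm n (by omega) (hN n (by omega) y hy)⟩

theorem body_inter_compl_eq_empty {n : ℕ} {S : Finset (Cube d)}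
    (h : body n (S : Set (Cube d)) ⊆ box d n) :
    ¬ (body n (S : Set (Cube d)) ∩ body n (boxCubes d n)ᶜ).Nonempty := by
  rintro ⟨x, hx, hx'⟩
  obtain ⟨a, ha, hxa⟩ := mem_body.1 hx'
  exact ha ⟨x, hxa, h hx⟩

theorem exists_child {n : ℕ} {a : Cube d} {x : Space d} (hx : x ∈ cube n a) :
    ∃ b, x ∈ cube (n + 1) b ∧ cube (n + 1) b ⊆ cube n a := by
  classical
  let b : Cube d := fun i => if x i * 2 ^ (n + 1) ≤ 2 * a i + 1 then 2 * a i else 2 * a i + 1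
  refine ⟨b, mem_cube_iff.2 fun i => ?_, ?_⟩
  · have h := mem_cube_iff.1 hx i
    simp only [b]
    split_ifs with hi
    · push_cast
      refine ⟨?_, hi⟩
      rw [pow_succ]; linarith [h.1]
    · push_cast
      refine ⟨(not_le.1 hi).le, ?_⟩
      rw [pow_succ]; linarith [h.2]
  · have : parent b = a := by
      funext i
      simp only [parent, b]
      split_ifs <;> omega
    rw [← this]
    exact cube_subset_parent n b

/-- The bodies of sets of cubes that are closed under refinement increase. -/
theorem monotone_body_of_refine {S : ℕ → Finset (Cube d)}
    (h : ∀ n, ∀ a ∈ S n, ∀ b : Cube d, cube (n + 1) b ⊆ cube n a → b ∈ S (n + 1)) :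
    Monotone fun n => body n (S n : Set (Cube d)) := by
  refine monotone_nat_of_le_succ fun n x hx => ?_
  obtain ⟨a, ha, hxa⟩ := mem_body.1 hx
  obtain ⟨b, hxb, hb⟩ := exists_child hxa
  exact mem_body.2 ⟨b, h n a ha b hb, hxb⟩

/-- The algorithm halts on escaping instances: for large `n` the set `P_{k+1}` of stage `n` is
empty, where `k + 1` is the first time at which the orbit is outside of `A`. -/
theorem pointEscape_dom_of_escapes (hF : IsFunctionName F f) (hA : IsClosedName I E A)
    (hX : IsPointName X x₀) (hx : x₀ ∈ A) (hesc : Escapes f A x₀) :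
    (pointEscape F I E X).Dom := by
  classical
  obtain ⟨k, hk⟩ : ∃ k, Nat.find hesc = k + 1 := Nat.exists_eq_succ_of_ne_zero fun h0 =>
    Nat.find_spec hesc (by rw [h0]; exact hx)
  have hk1 : f^[k + 1] x₀ ∉ A := hk ▸ Nat.find_spec hesc
  have hk2 : ∀ i ≤ k, f^[i] x₀ ∈ A := fun i hi => by
    simpa using Nat.find_min hesc (m := i) (by omega)
  -- `m` and `ε` with the `ε`-ball about the escaping point inside `|E_m|`
  have hmem : f^[k + 1] x₀ ∈ ⋃ n, interior (body n (E n : Set (Cube d))) := by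
    rw [← hA.compl_eq]; exact hk1
  obtain ⟨m, hm⟩ := mem_iUnion.1 hmem
  obtain ⟨ε, hε, hball⟩ := Metric.isOpen_iff.1 isOpen_interior _ hm
  have hEA : ∀ n, body n (E n : Set (Cube d)) ⊆ (A : Set (Space d))ᶜ := fun n =>
    subset_closure.trans ((hA.outer_wellInside n).trans interior_subset)
  choose N₁ h₁ using fun i => exists_iterate_subset_box hF hX (i := i)
  choose N₂ h₂ using fun i => exists_body_iterate_close hF hX i (half_pos hε)
  let n := max m ((Finset.range (k + 2)).sup fun i => max (N₁ i) (N₂ i))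
  have hn : ∀ i ≤ k + 1, max (N₁ i) (N₂ i) ≤ n := fun i hi =>
    (Finset.le_sup (f := fun i => max (N₁ i) (N₂ i)) (Finset.mem_range.2 (by omega))).trans
      (le_max_right _ _)
  have hbox : ∀ i ≤ k + 1, body n (((setImage (F n))^[i] (X n) : Finset (Cube d)) : Set (Cube d))
      ⊆ box d n := fun i hi => h₁ i n ((le_max_left _ _).trans (hn i hi))
  have hclose : ∀ i ≤ k + 1, ∀ y ∈ body n (((setImage (F n))^[i] (X n) : Finset (Cube d)) :
      Set (Cube d)), dist y (f^[i] x₀) < ε / 2 :=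
    fun i hi => h₂ i n ((le_max_right _ _).trans (hn i hi))
  have hEmono := monotone_body_of_refine hA.outer_refine
  have hballE : Metric.ball (f^[k + 1] x₀) ε ⊆ interior (body n (E n : Set (Cube d))) :=
    hball.trans (interior_mono (hEmono (le_max_left _ _)))
  have hPk : (loopState n (F n) (E n) (X n) k).P = ∅ := by
    have hsub : ∀ a ∈ (loopState n (F n) (E n) (X n) k).Q,
        WellInside (cube n a) (body n (E n : Set (Cube d))) := by
      intro a ha
      rw [WellInside, (isCompact_cube n a).isClosed.closure_eq]
      rw [loopState_Q] at ha
      exact fun y hy => hballE ((hclose (k + 1) le_rfl y (mem_body.2 ⟨a, ha, hy⟩)).trans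
        (half_lt_self hε))
    refine Finset.eq_empty_of_forall_notMem fun a ha => ?_
    have hQ := loopState_P_subset k ha
    cases k with
    | zero => exact (mem_notExcluded.1 ha).2 (hsub a hQ)
    | succ k =>
      rw [loopState_succ] at ha
      exact (mem_notExcluded.1 ha).2 (hsub a hQ)
  refine pointEscape_dom (n := n) fun hnone => ?_
  rcases none_mem_stage hnone with h | h | ⟨j, hP, h⟩
  · exact body_inter_compl_eq_empty (hbox 0 (by omega)) h
  · rw [loopState_Q] at h
    exact h (subset_boxCubes_of_body_subset (hbox 1 (by omega)))
  have hjk : j + 1 < k := by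
    by_contra hcon
    exact hP (loopState_P_eq_empty hPk (not_lt.1 hcon))
  rcases h with h | ⟨hO, -⟩
  · rw [loopState_Q] at h
    exact h (subset_boxCubes_of_body_subset (hbox _ (by omega)))
  -- the loop has become stationary before the orbit escapes, so the escaping point is close to an
  -- earlier point of the orbit
  have hstat : ∀ i, (loopState n (F n) (E n) (X n) i).Q ⊆ (loopState n (F n) (E n) (X n) j).O := by
    intro i
    induction i with
    | zero => exact fun a ha => mem_loopState_O.2 ⟨0, Nat.zero_le _, ha⟩
    | succ i ih =>
      rw [loopState_succ]
      refine (setImage_mono ih).trans ?_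
      conv_rhs => rw [hO]
      exact setImage_loopState_O j
  have hxk := iterate_mem_body hF hX (n := n) (i := k + 1)
    fun l hl => subset_boxCubes_of_body_subset (hbox l (by omega))
  obtain ⟨a, ha, hxa⟩ := mem_body.1 hxk
  rw [← loopState_Q (E := E n)] at ha
  obtain ⟨i, hi, hai⟩ := mem_loopState_O.1 (hstat k ha)
  rw [loopState_Q] at hai
  have h3 := hclose (i + 1) (by omega) _ (mem_body.2 ⟨a, hai, hxa⟩)
  refine hEA n (interior_subset (hballE ?_)) (hk2 (i + 1) (by omega))
  rw [Metric.mem_ball, dist_comm]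
  linarith

/-- The algorithm halts in the presence of a robust invariant `V`: for large `n` all cubes that
occur in stage `n` are contained in `V`. -/
theorem pointEscape_dom_of_robust (hF : IsFunctionName F f) (hA : IsClosedName I E A)
    (hX : IsPointName X x₀) {V : Set (Space d)} (hV : IsRobustInvariant f V)
    (hVA : V ⊆ interior (A : Set (Space d))) (hfx : f x₀ ∈ interior V) :
    (pointEscape F I E X).Dom := by
  obtain ⟨δ, hδ, hthick⟩ := (hV.1.image f.continuous).exists_thickening_subset_open
    isOpen_interior hV.2
  obtain ⟨N₁, h₁⟩ := hF.exists_dist_lt hV.1.isBounded hδ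
  obtain ⟨ε, hε, hball⟩ := Metric.isOpen_iff.1 isOpen_interior _ hfx
  obtain ⟨N₂, h₂⟩ := exists_body_iterate_close hF hX 1 hε
  obtain ⟨N₃, h₃⟩ := exists_iterate_subset_box hF hX 0
  obtain ⟨N₄, h₄⟩ := exists_subset_box hV.1.isBounded
  have hImono := monotone_body_of_refine hA.inner_refine
  obtain ⟨N₅, h₅⟩ := hV.1.elim_directed_cover (fun n => interior (body n (I n : Set (Cube d))))
    (fun _ => isOpen_interior) (hA.interior_eq ▸ hVA)
    (Monotone.directed_le fun _ _ h => interior_mono (hImono h))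
  obtain ⟨n, hn₁, hn₂, hn₃, hn₄, hn₅⟩ : ∃ n, N₁ ≤ n ∧ N₂ ≤ n ∧ N₃ ≤ n ∧ N₄ ≤ n ∧ N₅ ≤ n :=
    ⟨N₁ + N₂ + N₃ + N₄ + N₅, by omega, by omega, by omega, by omega, by omega⟩
  have hQV : ∀ i, body n ((loopState n (F n) (E n) (X n) i).Q : Set (Cube d)) ⊆ V := by
    intro i
    induction i with
    | zero => exact fun y hy => interior_subset (hball (h₂ n hn₂ y hy))
    | succ i ih =>
      intro y hy
      obtain ⟨b, hb, hyb⟩ := mem_body.1 hy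
      rw [loopState_succ] at hb
      obtain ⟨a, ha, hab⟩ := Finset.mem_biUnion.1 (Finset.mem_coe.1 hb)
      obtain ⟨z, hz⟩ := cube_nonempty n a
      have hzV := ih (mem_body.2 ⟨a, ha, hz⟩)
      exact interior_subset (hthick (Metric.mem_thickening_iff.2 ⟨f z, mem_image_of_mem f hzV,
        h₁ n hn₁ a ⟨z, hz, hzV⟩ z hz y (mem_body.2 ⟨b, hab, hyb⟩)⟩))
  have hbox : ∀ i, ((loopState n (F n) (E n) (X n) i).Q : Set (Cube d)) ⊆ boxCubes d n := fun i =>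
    subset_boxCubes_of_body_subset ((hQV i).trans (h₄ n hn₄))
  refine pointEscape_dom (n := n) fun hnone => ?_
  rcases none_mem_stage hnone with h | h | ⟨j, -, h | ⟨-, hI⟩⟩
  · exact body_inter_compl_eq_empty (h₃ n hn₃) h
  · exact h (hbox 0)
  · exact h (hbox _)
  · refine hI ?_
    rw [WellInside, (isCompact_body _ _).isClosed.closure_eq]
    refine fun y hy => interior_mono (hImono hn₅) (h₅ ?_)
    obtain ⟨a, ha, hya⟩ := mem_body.1 hy
    obtain ⟨i, -, hai⟩ := mem_loopState_O.1 ha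
    exact hQV i (mem_body.2 ⟨a, hai, hya⟩)

end

/-! ### Pseudo-orbits and perturbations -/

/-- A continuous map can be changed to take prescribed values on a finite set, staying `ε`-close to
the given map on a ball where the prescribed values are `ε`-close. -/
theorem exists_perturbation (f : C(Space d, Space d)) (S : Set (Space d)) (hS : S.Finite)
    (v : Space d → Space d) {R ε : ℝ} (hε : 0 < ε)
    (hv : ∀ s ∈ S, ‖s‖ ≤ R → dist (v s) (f s) ≤ ε) :
    ∃ g : C(Space d, Space d), (∀ s ∈ S, g s = v s) ∧ ∀ x, ‖x‖ ≤ R → dist (g x) (f x) ≤ ε := by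
  have : Finite S := hS
  obtain ⟨w, hw⟩ := ContinuousMap.exists_restrict_eq hS.isClosed
    (⟨fun s : S => v s - f s, continuous_of_discreteTopology⟩ : C(S, Space d))
  have hw' : ∀ s ∈ S, w s = v s - f s := fun s hs => DFunLike.congr_fun hw ⟨s, hs⟩
  -- the interpolating function `w` is cut off at a bound `b` that is at most `ε` on the ball
  let C : ℝ := ∑ s ∈ hS.toFinset, ‖v s - f s‖ / max 0 (‖s‖ - R)
  let b : Space d → ℝ := fun x => ε + C * max 0 (‖x‖ - R)
  have hC : 0 ≤ C := Finset.sum_nonneg fun s _ => by positivity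
  have hb0 : ∀ x, 0 ≤ b x := fun x => by positivity
  have hbR : ∀ x, ‖x‖ ≤ R → b x = ε := fun x hx => by
    simp [b, max_eq_left (sub_nonpos.2 hx)]
  have hbS : ∀ s ∈ S, ‖v s - f s‖ ≤ b s := by
    intro s hs
    by_cases hR : ‖s‖ ≤ R
    · rw [hbR s hR, ← dist_eq_norm]
      exact hv s hs hR
    · have hpos : 0 < max 0 (‖s‖ - R) := lt_max_of_lt_right (by linarith)
      have h1 : ‖v s - f s‖ / max 0 (‖s‖ - R) ≤ C :=
        Finset.single_le_sum (f := fun s => ‖v s - f s‖ / max 0 (‖s‖ - R))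
          (fun s _ => by positivity) (hS.mem_toFinset.2 hs)
      rw [div_le_iff₀ hpos] at h1
      simp only [b]
      linarith
  refine ⟨⟨fun x i => f x i + max (-b x) (min (b x) (w x i)), by fun_prop⟩, fun s hs => ?_,
    fun x hx => ?_⟩
  · funext i
    have h1 : |w s i| ≤ b s := by
      rw [← Real.norm_eq_abs]
      exact (norm_le_pi_norm (w s) i).trans (by rw [hw' s hs]; exact hbS s hs)
    rw [abs_le] at h1
    simp only [ContinuousMap.coe_mk]
    rw [min_eq_right h1.2, max_eq_right h1.1, hw' s hs]
    simp
  · rw [dist_pi_le_iff hε.le]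
    intro i
    have h1 := hbR x hx
    have h2 := hb0 x
    simp only [ContinuousMap.coe_mk]
    rw [Real.dist_eq, add_sub_cancel_left, abs_le, ← h1]
    exact ⟨le_max_left _ _, max_le (by linarith) (min_le_left _ _)⟩

theorem exists_seq_of_reflTransGen {α : Type*} {r : α → α → Prop} {a b : α}
    (h : Relation.ReflTransGen r a b) :
    ∃ (k : ℕ) (y : ℕ → α), y 0 = a ∧ y k = b ∧ ∀ i < k, r (y i) (y (i + 1)) := by
  induction h with
  | refl => exact ⟨0, fun _ => a, rfl, rfl, by simp⟩
  | @tail b c _ hbc ih =>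
    obtain ⟨k, y, h0, hk, hy⟩ := ih
    refine ⟨k + 1, fun i => if i ≤ k then y i else c, by simpa, by simp, fun i hi => ?_⟩
    rcases Nat.lt_succ_iff_lt_or_eq.1 hi with hi | rfl
    · simpa [hi.le, Nat.succ_le_iff.2 hi] using hy i hi
    · simpa [hk] using hbc

/-- A shortest path has no repetitions. -/
theorem exists_injOn_seq_of_reflTransGen {α : Type*} {r : α → α → Prop} {a b : α}
    (h : Relation.ReflTransGen r a b) :
    ∃ (k : ℕ) (y : ℕ → α), y 0 = a ∧ y k = b ∧ (∀ i < k, r (y i) (y (i + 1))) ∧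
      InjOn y (Iic k) := by
  classical
  have hex := exists_seq_of_reflTransGen h
  obtain ⟨y, h0, hk, hy⟩ := Nat.find_spec hex
  refine ⟨_, y, h0, hk, hy, ?_⟩
  suffices hlt : ∀ i j, i < j → j ≤ Nat.find hex → y i ≠ y j by
    intro i hi j hj hij
    rcases lt_trichotomy i j with h1 | h1 | h1
    · exact absurd hij (hlt i j h1 hj)
    · exact h1
    · exact absurd hij.symm (hlt j i h1 hi)
  intro i j hij hj heq
  -- a repetition could be cut out
  refine Nat.find_min hex (m := Nat.find hex - (j - i)) (by omega)
    ⟨fun l => if l ≤ i then y l else y (l + (j - i)), by simpa, ?_, fun l hl => ?_⟩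
  · dsimp only
    split_ifs with h1
    · have : j = Nat.find hex := by omega
      rw [show Nat.find hex - (j - i) = i by omega, heq, this, hk]
    · rw [Nat.sub_add_cancel (by omega), hk]
  · dsimp only
    split_ifs with h1 h2 h2
    · exact hy l (by omega)
    · obtain rfl : l = i := by omega
      have := hy j (by omega)
      rw [heq]
      convert this using 2
      omega
    · omega
    · have := hy (l + (j - i)) (by omega)
      convert this using 2
      omega

/-- A pseudo-orbit that is `ε`-close to an orbit inside the ball of radius `R` is an orbit of a map
that is `ε`-close to the given one on this ball. -/
theorem exists_perturbation_of_pseudoOrbit (f : C(Space d, Space d)) {R ε : ℝ} (hε : 0 < ε)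
    {x₀ z : Space d}
    (h : Relation.ReflTransGen (fun a b => R < ‖a‖ ∨ dist b (f a) < ε) x₀ z) :
    ∃ g : C(Space d, Space d), (∀ x, ‖x‖ ≤ R → dist (g x) (f x) ≤ ε) ∧ ∃ k : ℕ, g^[k] x₀ = z := by
  obtain ⟨k, y, h0, hk, hy, hinj⟩ := exists_injOn_seq_of_reflTransGen h
  let v : Space d → Space d := fun s => y (Function.invFunOn y (Iic k) s + 1)
  have hv : ∀ i ≤ k, v (y i) = y (i + 1) := fun i hi => by
    simp only [v]
    rw [hinj.leftInvOn_invFunOn hi]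
  obtain ⟨g, hg, hgf⟩ := exists_perturbation f (y '' Iio k) ((finite_Iio k).image y) v hε
    (R := R) (by
      rintro _ ⟨i, hi, rfl⟩ hR
      rw [hv i (le_of_lt hi)]
      exact ((hy i hi).resolve_left (not_lt.2 hR)).le)
  refine ⟨g, hgf, k, ?_⟩
  have : ∀ i ≤ k, g^[i] x₀ = y i := by
    intro i
    induction i with
    | zero => intro _; exact h0.symm
    | succ i ih =>
      intro hi
      rw [Function.iterate_succ_apply', ih (by omega), hg _ ⟨i, by simpa using hi, rfl⟩,
        hv i (by omega)]
  rw [this k le_rfl, hk]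

/-- The points that pseudo-orbits reach form a robust invariant (up to closure), unless they are
unbounded. -/
theorem exists_robust_of_pseudoOrbits (f : C(Space d, Space d)) {B : Set (Space d)} {x₀ : Space d}
    {ε : ℝ} (hε : 0 < ε)
    (hbdd : Bornology.IsBounded {y | Relation.TransGen (fun a b => dist b (f a) < ε) x₀ y})
    (hB : closure {y | Relation.TransGen (fun a b => dist b (f a) < ε) x₀ y} ⊆ B) :
    ∃ V : Set (Space d), IsRobustInvariant f V ∧ V ⊆ B ∧ f x₀ ∈ interior V := by
  set S := {y | Relation.TransGen (fun a b => dist b (f a) < ε) x₀ y} with hS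
  have hopen : IsOpen S := by
    refine Metric.isOpen_iff.2 fun y hy => ?_
    obtain ⟨a, ha, hay⟩ := Relation.TransGen.tail'_iff.1 hy
    refine ⟨ε - dist y (f a), by linarith, fun z hz => Relation.TransGen.tail' ha ?_⟩
    rw [Metric.mem_ball] at hz
    linarith [dist_triangle z y (f a)]
  have hint : S ⊆ interior (closure S) := hopen.subset_interior_iff.2 subset_closure
  refine ⟨closure S, ⟨hbdd.isCompact_closure, ?_⟩, hB,
    hint (Relation.TransGen.single (by simpa using hε))⟩
  rintro _ ⟨x, hx, rfl⟩
  obtain ⟨δ, hδ, hfδ⟩ := Metric.continuousAt_iff.1 (f.continuous.continuousAt (x := x)) ε hε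
  obtain ⟨z, hz, hxz⟩ := Metric.mem_closure_iff.1 hx δ hδ
  refine hint (Relation.TransGen.tail hz ?_)
  rw [dist_comm]
  exact hfδ (by rwa [dist_comm])

theorem exists_norm_gt_of_not_isBounded {S : Set (Space d)} (hS : ¬ Bornology.IsBounded S)
    (R : ℝ) : ∃ y ∈ S, R < ‖y‖ := by
  by_contra! hcon
  exact hS ((Metric.isBounded_closedBall (x := (0 : Space d)) (r := R)).subset fun y hy => by
    simpa using hcon y hy)

/-- If `x₀` is not robustly trapped in `A ≠ ℝ^d`, then it escapes `A` under maps that are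
arbitrarily close to `f` on a given ball. -/
theorem exists_perturbation_escapes (f : C(Space d, Space d))
    {A : TopologicalSpace.Closeds (Space d)} {x₀ : Space d}
    (hV : ¬ ∃ V : Set (Space d), IsRobustInvariant f V ∧ V ⊆ interior (A : Set (Space d)) ∧
      f x₀ ∈ interior V) (hA : (A : Set (Space d)) ≠ univ) (R : ℝ) {ε : ℝ} (hε : 0 < ε) :
    ∃ g : C(Space d, Space d), (∀ x, ‖x‖ ≤ R → dist (g x) (f x) ≤ ε) ∧ Escapes g A x₀ := by
  suffices h : ∃ z, z ∉ A ∧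
      Relation.ReflTransGen (fun a b => R < ‖a‖ ∨ dist b (f a) < ε) x₀ z by
    obtain ⟨z, hz, hc⟩ := h
    obtain ⟨g, hg, k, hk⟩ := exists_perturbation_of_pseudoOrbit f hε hc
    exact ⟨g, hg, k, by rwa [hk]⟩
  have hle : ∀ {y}, Relation.ReflTransGen (fun a b => dist b (f a) < ε / 2) x₀ y →
      Relation.ReflTransGen (fun a b => R < ‖a‖ ∨ dist b (f a) < ε) x₀ y := fun h =>
    Relation.ReflTransGen.mono (fun a b (hab : dist b (f a) < ε / 2) =>
      Or.inr (hab.trans (half_lt_self hε))) _ _ h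
  -- `ε / 2` leaves room to move the last point of a pseudo-orbit by `ε / 2`, from the closure of
  -- the reachable set to the complement of `A`
  by_cases hbdd :
      Bornology.IsBounded {y | Relation.TransGen (fun a b => dist b (f a) < ε / 2) x₀ y}
  · have hcl : ¬ closure {y | Relation.TransGen (fun a b => dist b (f a) < ε / 2) x₀ y} ⊆
        interior (A : Set (Space d)) := fun hcl =>
      hV (exists_robust_of_pseudoOrbits f (half_pos hε) hbdd hcl)
    obtain ⟨y, hy, hyA⟩ := not_subset.1 hcl
    rw [← mem_compl_iff, ← closure_compl] at hyA
    obtain ⟨z, hz, hyz⟩ := Metric.mem_closure_iff.1 hy (ε / 4) (by linarith)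
    obtain ⟨w, hw, hyw⟩ := Metric.mem_closure_iff.1 hyA (ε / 4) (by linarith)
    obtain ⟨a, ha, haz⟩ := Relation.TransGen.tail'_iff.1 hz
    refine ⟨w, hw, (hle ha).tail (Or.inr ?_)⟩
    have h1 := dist_triangle w y z
    have h2 := dist_triangle w z (f a)
    rw [dist_comm w y] at h1
    linarith
  · obtain ⟨y, hy, hyR⟩ := exists_norm_gt_of_not_isBounded hbdd R
    -- outside of the ball the pseudo-orbit may jump to any point of the complement of `A`
    obtain ⟨z, hz⟩ := (ne_univ_iff_exists_notMem _).1 hA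
    exact ⟨z, hz, (hle hy.to_reflTransGen).tail (Or.inl hyR)⟩

/-- If no robust invariant contains `f x₀` in its interior, then some maps that are arbitrarily
close to `f` on a given ball take `x₀` out of this ball. -/
theorem exists_perturbation_norm_gt (f : C(Space d, Space d)) {x₀ : Space d}
    (hV : ¬ ∃ V : Set (Space d), IsRobustInvariant f V ∧ f x₀ ∈ interior V)
    (R : ℝ) {ε : ℝ} (hε : 0 < ε) :
    ∃ g : C(Space d, Space d), (∀ x, ‖x‖ ≤ R → dist (g x) (f x) ≤ ε) ∧
      ∃ k : ℕ, R < ‖g^[k] x₀‖ := by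
  have hbdd : ¬ Bornology.IsBounded
      {y | Relation.TransGen (fun a b => dist b (f a) < ε) x₀ y} := fun hbdd => by
    obtain ⟨V, h1, -, h2⟩ := exists_robust_of_pseudoOrbits f hε hbdd (subset_univ _)
    exact hV ⟨V, h1, h2⟩
  obtain ⟨y, hy, hyR⟩ := exists_norm_gt_of_not_isBounded hbdd R
  obtain ⟨g, hg, k, hk⟩ := exists_perturbation_of_pseudoOrbit f (R := R) hε
    (Relation.ReflTransGen.mono (fun a b (hab : dist b (f a) < ε) => Or.inr hab) _ _
      hy.to_reflTransGen)
  exact ⟨g, hg, k, by rwa [hk]⟩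

/-! ### Construction of names -/

theorem finite_cubes_inter_nonempty (n : ℕ) {K : Set (Space d)} (hK : Bornology.IsBounded K) :
    {a : Cube d | (cube n a ∩ K).Nonempty}.Finite := by
  obtain ⟨R, hR⟩ := hK.subset_closedBall 0
  refine (Set.finite_Icc (fun _ : Fin d => ⌊-R * 2 ^ n⌋ - 1) (fun _ => ⌈R * 2 ^ n⌉)).subset ?_
  rintro a ⟨x, hxa, hxK⟩
  have hx : ∀ i, |x i| ≤ R := fun i => by
    rw [← Real.norm_eq_abs]
    exact (norm_le_pi_norm x i).trans (by simpa using hR hxK)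
  have h2 : (0 : ℝ) < 2 ^ n := by positivity
  have hxa := mem_cube_iff.1 hxa
  constructor <;> intro i <;> dsimp only
  · have h3 : -R * 2 ^ n ≤ x i * 2 ^ n := by gcongr; exact (abs_le.1 (hx i)).1
    have h4 : (⌊-R * 2 ^ n⌋ : ℝ) ≤ a i + 1 := (Int.floor_le _).trans (h3.trans (hxa i).2)
    have h5 : ⌊-R * 2 ^ n⌋ ≤ a i + 1 := by exact_mod_cast h4
    omega
  · have h3 : x i * 2 ^ n ≤ R * 2 ^ n := by gcongr; exact (abs_le.1 (hx i)).2
    have h4 : (a i : ℝ) ≤ ⌈R * 2 ^ n⌉ := ((hxa i).1.trans h3).trans (Int.le_ceil _)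
    exact_mod_cast h4

open Classical in
/-- The set of all cubes of level `n` that meet the bounded set `K` (and the empty set if there are
infinitely many of them). -/
def meetingCubes (n : ℕ) (K : Set (Space d)) : Finset (Cube d) :=
  if h : {a : Cube d | (cube n a ∩ K).Nonempty}.Finite then h.toFinset else ∅

theorem mem_meetingCubes {n : ℕ} {K : Set (Space d)} (hK : Bornology.IsBounded K) {a : Cube d} :
    a ∈ meetingCubes n K ↔ (cube n a ∩ K).Nonempty := by
  simp [meetingCubes, finite_cubes_inter_nonempty n hK]

theorem subset_body_meetingCubes (n : ℕ) {K : Set (Space d)} (hK : Bornology.IsBounded K) :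
    K ⊆ body n (meetingCubes n K : Set (Cube d)) := fun x hx =>
  mem_body.2 ⟨floorCube n x, (mem_meetingCubes hK).2 ⟨x, mem_cube_floorCube n x, hx⟩,
    mem_cube_floorCube n x⟩

theorem body_meetingCubes_subset (n : ℕ) {K : Set (Space d)} (hK : Bornology.IsBounded K) :
    body n (meetingCubes n K : Set (Cube d)) ⊆ Metric.cthickening ((2 : ℝ) ^ n)⁻¹ K := by
  intro y hy
  obtain ⟨a, ha, hya⟩ := mem_body.1 hy
  obtain ⟨z, hza, hzK⟩ := (mem_meetingCubes hK).1 ha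
  exact Metric.mem_cthickening_of_dist_le y z _ K hzK (dist_le_of_mem_cube hya hza)

theorem tendsto_diam_image {f : C(Space d, Space d)} {m : ℕ} {Q : ℕ → Cube d}
    (hQ : ∀ n, m ≤ n → cube (n + 1) (Q (n + 1)) ⊆ cube n (Q n)) :
    Tendsto (fun n => Metric.diam (f '' cube n (Q n))) atTop (𝓝 0) := by
  have hsub : ∀ n, m ≤ n → cube n (Q n) ⊆ cube m (Q m) := by
    intro n hn
    induction n, hn using Nat.le_induction with
    | base => exact subset_rfl
    | succ n hn ih => exact (hQ n hn).trans ih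
  have huc := (isCompact_cube m (Q m)).uniformContinuousOn_of_continuous f.continuous.continuousOn
  rw [Metric.uniformContinuousOn_iff] at huc
  rw [Metric.tendsto_atTop]
  intro ε hε
  obtain ⟨δ, hδ, hfδ⟩ := huc (ε / 2) (half_pos hε)
  obtain ⟨N, hN⟩ := eventually_atTop.1 (tendsto_inv_two_pow.eventually (gt_mem_nhds hδ))
  refine ⟨max N m, fun n hn => ?_⟩
  rw [Real.dist_0_eq_abs, abs_of_nonneg Metric.diam_nonneg]
  refine (Metric.diam_le_of_forall_dist_le (half_pos hε).le ?_).trans_lt (half_lt_self hε)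
  rintro _ ⟨x, hx, rfl⟩ _ ⟨y, hy, rfl⟩
  exact (hfδ x (hsub n (by omega) hx) y (hsub n (by omega) hy)
    ((dist_le_of_mem_cube hx hy).trans_lt (hN n (by omega)))).le

/-- Approximations `h m` of `g`, fattened by radii `r m` that leave enough room for the size of the
cubes and for the steps from `h m` to `h (m + 1)`, yield a name of `g`. -/
theorem isFunctionName_meetingCubes (g : C(Space d, Space d)) (h : ℕ → C(Space d, Space d))
    (r e : ℕ → ℝ) (hr : ∀ m, 0 ≤ r m) (he : ∀ m, 0 ≤ e m)
    (hg : ∀ m, ∀ a ∈ boxCubes d m, ∀ x ∈ cube m a, dist (g x) (h m x) < r m)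
    (hstep : ∀ m, ∀ a ∈ boxCubes d m, ∀ x ∈ cube m a, dist (h (m + 1) x) (h m x) ≤ e m)
    (hroom : ∀ m, ((2 : ℝ) ^ (m + 1))⁻¹ + (r (m + 1) + e m) ≤ r m)
    (hev : ∀ᶠ m in atTop, h m = g) (hlim : Tendsto r atTop (𝓝 0)) :
    IsFunctionName (fun m a => meetingCubes m (Metric.cthickening (r m) (h m '' cube m a))) g := by
  have hbdd : ∀ m a, Bornology.IsBounded (Metric.cthickening (r m) (h m '' cube m a)) :=
    fun m a => ((isCompact_cube m a).image (h m).continuous).isBounded.cthickening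
  refine ⟨fun m a ha => ?_, fun m a ha b _ hba => ?_, fun m Q _ hQ _ => ?_⟩
  · rintro _ ⟨x, hx, rfl⟩
    refine interior_maximal ((Metric.thickening_subset_cthickening _ _).trans
      (subset_body_meetingCubes m (hbdd m a))) Metric.isOpen_thickening ?_
    exact Metric.mem_thickening_iff.2 ⟨h m x, mem_image_of_mem _ hx, hg m a ha x hx⟩
  · refine (body_meetingCubes_subset _ (hbdd _ b)).trans
      (LE.le.trans ?_ (subset_body_meetingCubes m (hbdd m a)))
    have h1 : h (m + 1) '' cube (m + 1) b ⊆ Metric.cthickening (e m) (h m '' cube m a) := by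
      rintro _ ⟨x, hx, rfl⟩
      exact Metric.mem_cthickening_of_dist_le _ (h m x) _ _ (mem_image_of_mem _ (hba hx))
        (hstep m a ha x (hba hx))
    refine (Metric.cthickening_cthickening_subset (by positivity) (hr _) _).trans
      ((Metric.cthickening_subset_of_subset _ h1).trans
        ((Metric.cthickening_cthickening_subset (add_nonneg (by positivity) (hr _)) (he _) _).trans
          (Metric.cthickening_mono ?_ _)))
    linarith [hroom m]
  · have hd := tendsto_diam_image (f := g) hQ
    have hs : Tendsto (fun n : ℕ => Metric.diam (g '' cube n (Q n)) +
        2 * (((2 : ℝ) ^ n)⁻¹ + r n)) atTop (𝓝 0) := by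
      simpa using hd.add ((tendsto_inv_two_pow.add hlim).const_mul 2)
    refine squeeze_zero' (Eventually.of_forall fun _ => Metric.diam_nonneg) ?_ hs
    filter_upwards [hev] with n hn
    have hb := ((isCompact_cube n (Q n)).image g.continuous).isBounded
    have hnn : 0 ≤ ((2 : ℝ) ^ n)⁻¹ + r n := add_nonneg (by positivity) (hr n)
    refine (Metric.diam_mono ((body_meetingCubes_subset _ (hbdd _ _)).trans
      (Metric.cthickening_cthickening_subset (by positivity) (hr _) _)) ?_).trans ?_
    · rw [hn]; exact hb.cthickening
    · rw [hn]; exact Metric.diam_cthickening_le _ hnn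

theorem tendsto_two_mul_inv : Tendsto (fun m : ℕ => 2 * ((2 : ℝ) ^ m)⁻¹) atTop (𝓝 0) := by
  simpa using tendsto_inv_two_pow.const_mul 2

/-- The standard name of a function; its radii `2 * 2 ^ (-m)` leave room for the names of nearby
functions with radii `2 ^ (-m)`. -/
theorem isFunctionName_standard (f : C(Space d, Space d)) :
    IsFunctionName (fun m a =>
      meetingCubes m (Metric.cthickening (2 * ((2 : ℝ) ^ m)⁻¹) (f '' cube m a))) f := by
  refine isFunctionName_meetingCubes f (fun _ => f) _ (fun _ => 0) (fun _ => by positivity)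
    (fun _ => le_rfl) (fun _ _ _ _ _ => by simp) (fun _ _ _ _ _ => by simp) (fun m => ?_)
    (by simp) tendsto_two_mul_inv
  have : (0 : ℝ) < (2 ^ m)⁻¹ := by positivity
  rw [pow_succ, mul_inv]
  linarith

theorem norm_le_of_mem_cube {n : ℕ} {a : Cube d} (ha : a ∈ boxCubes d n) {x : Space d}
    (hx : x ∈ cube n a) : ‖x‖ ≤ 2 ^ (n + 1) := by
  rw [pi_norm_le_iff_of_nonneg (by positivity)]
  intro i
  rw [Real.norm_eq_abs, abs_le]
  exact cube_subset_box_succ ha hx i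

/-- A map that is close to `f` on a large ball has a name that agrees with the standard name of `f`
up to level `N`. -/
theorem exists_functionName_agreeing {f g : C(Space d, Space d)} {N : ℕ}
    (hfg : ∀ x, ‖x‖ ≤ 2 ^ (N + 1) → dist (g x) (f x) ≤ ((2 : ℝ) ^ N)⁻¹) :
    ∃ G : ℕ → Cube d → Finset (Cube d), IsFunctionName G g ∧ ∀ m ≤ N, G m = fun a =>
      meetingCubes m (Metric.cthickening (2 * ((2 : ℝ) ^ m)⁻¹) (f '' cube m a)) := by
  have hpos : ∀ m : ℕ, (0 : ℝ) < (2 ^ m)⁻¹ := fun m => by positivity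
  have hclose : ∀ m ≤ N, ∀ a ∈ boxCubes d m, ∀ x ∈ cube m a,
      dist (g x) (f x) ≤ ((2 : ℝ) ^ N)⁻¹ := fun m hm a ha x hx =>
    hfg x ((norm_le_of_mem_cube ha hx).trans (pow_le_pow_right₀ (by norm_num) (by omega)))
  refine ⟨_, isFunctionName_meetingCubes g (fun m => if m ≤ N then f else g)
    (fun m => if m ≤ N then 2 * ((2 : ℝ) ^ m)⁻¹ else ((2 : ℝ) ^ m)⁻¹)
    (fun m => if m = N then ((2 : ℝ) ^ N)⁻¹ else 0) (fun m => ?_) (fun m => ?_)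
    (fun m a ha x hx => ?_) (fun m a ha x hx => ?_) (fun m => ?_) ?_ ?_, fun m hm => ?_⟩
  · split_ifs <;> positivity
  · split_ifs <;> positivity
  · split_ifs with hm
    · have h1 : ((2 : ℝ) ^ N)⁻¹ ≤ (2 ^ m)⁻¹ :=
        inv_anti₀ (by positivity) (pow_le_pow_right₀ (by norm_num) hm)
      linarith [hclose m hm a ha x hx, hpos m]
    · simp
  · rcases lt_trichotomy m N with hm | rfl | hm
    · simp [hm.le, Nat.succ_le_iff.2 hm, hm.ne]
    · simpa using hclose m le_rfl a ha x hx
    · simp [hm.not_ge, show ¬ m + 1 ≤ N by omega, hm.ne']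
  · have h1 := hpos m
    rcases lt_trichotomy m N with hm | rfl | hm
    · simp only [hm.le, Nat.succ_le_iff.2 hm, hm.ne, if_true, if_false]
      rw [pow_succ, mul_inv]; linarith
    · simp only [le_refl, if_true, show ¬ m + 1 ≤ m by omega, if_false]
      rw [pow_succ, mul_inv]; linarith
    · simp only [hm.not_ge, show ¬ m + 1 ≤ N by omega, hm.ne', if_false]
      rw [pow_succ, mul_inv]; linarith
  · filter_upwards [eventually_gt_atTop N] with m hm
    simp [hm.not_ge]
  · refine tendsto_inv_two_pow.congr' ?_
    filter_upwards [eventually_gt_atTop N] with m hm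
    simp [hm.not_ge]
  · simp [hm]

open Classical in
/-- The cubes that meet the box of level `n` and are contained in `U`. -/
def cubesInside (n : ℕ) (U : Set (Space d)) : Finset (Cube d) :=
  (boxCubes_finite d n).toFinset.filter fun a => cube n a ⊆ U

theorem mem_cubesInside {n : ℕ} {U : Set (Space d)} {a : Cube d} :
    a ∈ cubesInside n U ↔ a ∈ boxCubes d n ∧ cube n a ⊆ U := by simp [cubesInside]

theorem wellInside_cubesInside {n : ℕ} {U B : Set (Space d)} (h : U ⊆ interior B) :
    WellInside (body n (cubesInside n U : Set (Cube d))) B := by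
  rw [wellInside_body_iff]
  intro a ha
  rw [WellInside, (isCompact_cube n a).isClosed.closure_eq]
  exact (mem_cubesInside.1 ha).2.trans h

theorem iUnion_interior_cubesInside {U : Set (Space d)} (hU : IsOpen U) :
    U = ⋃ n, interior (body n (cubesInside n U : Set (Cube d))) := by
  refine subset_antisymm (fun x hx => ?_) (iUnion_subset fun n => interior_subset.trans ?_)
  · obtain ⟨ε, hε, hball⟩ := Metric.isOpen_iff.1 hU x hx
    obtain ⟨m, hm⟩ := exists_subset_box (Metric.isBounded_ball (x := x) (r := 1))
    obtain ⟨n, h1, h2⟩ := ((tendsto_inv_two_pow.eventually (gt_mem_nhds (half_pos hε))).and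
      (eventually_ge_atTop m)).exists
    refine mem_iUnion.2 ⟨n, interior_maximal (s := body n _)
      (t := Metric.ball x (min 1 (ε / 2))) (fun y hy => ?_) Metric.isOpen_ball
      (Metric.mem_ball_self (by positivity))⟩
    rw [Metric.mem_ball] at hy
    refine mem_body.2 ⟨floorCube n y, mem_cubesInside.2 ⟨⟨y, mem_cube_floorCube n y, hm n h2 ?_⟩,
      fun z hz => hball ?_⟩, mem_cube_floorCube n y⟩
    · exact hy.trans_le (min_le_left _ _)
    · have h4 := dist_le_of_mem_cube hz (mem_cube_floorCube n y)
      have h5 := hy.trans_le (min_le_right _ _)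
      rw [Metric.mem_ball]
      linarith [dist_triangle z y x]
  · intro x hx
    obtain ⟨a, ha, hxa⟩ := mem_body.1 hx
    exact (mem_cubesInside.1 ha).2 hxa

theorem refine_cubesInside {n : ℕ} {U : Set (Space d)} {a b : Cube d} (ha : a ∈ cubesInside n U)
    (hb : cube (n + 1) b ⊆ cube n a) : b ∈ cubesInside (n + 1) U := by
  rw [mem_cubesInside] at ha ⊢
  exact ⟨mem_boxCubes_of_subset ha.1 hb, hb.trans ha.2⟩

/-- The standard name of a closed set. -/
theorem isClosedName_standard (A : TopologicalSpace.Closeds (Space d)) :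
    IsClosedName (fun n => cubesInside n (interior (A : Set (Space d))))
      (fun n => cubesInside n (A : Set (Space d))ᶜ) A where
  inner_wellInside _ := wellInside_cubesInside subset_rfl
  interior_eq := iUnion_interior_cubesInside isOpen_interior
  outer_wellInside _ := wellInside_cubesInside A.isClosed.isOpen_compl.interior_eq.ge
  compl_eq := iUnion_interior_cubesInside A.isClosed.isOpen_compl
  inner_refine _ _ ha _ hb := refine_cubesInside ha hb
  outer_refine _ _ ha _ hb := refine_cubesInside ha hb

/-! ### Coded names and convergence -/

theorem cubeOfList_ofFn (a : Cube d) : cubeOfList d (List.ofFn a) = a := by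
  funext i
  simp [cubeOfList, List.getD]

theorem mem_cubesOfList {L : List (List ℤ)} {a : Cube d} :
    a ∈ cubesOfList d L ↔ ∃ l ∈ L, cubeOfList d l = a := by simp [cubesOfList]

theorem cubesOfList_ofFn (S : Finset (Cube d)) :
    cubesOfList d (S.toList.map List.ofFn) = S := by
  ext a
  simp [mem_cubesOfList, cubeOfList_ofFn]

theorem exists_decodeCubes_eq (S : Finset (Cube d)) : ∃ k, decodeCubes d k = S :=
  ⟨Encodable.encode (S.toList.map List.ofFn), by
    rw [decodeCubes, Denumerable.ofNat_encode, cubesOfList_ofFn]⟩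

theorem exists_decodeMap_eq (n : ℕ) (G : Cube d → Finset (Cube d)) :
    ∃ k, ∀ a ∈ boxCubes d n, decodeMap d k a = G a := by
  refine ⟨Encodable.encode ((boxCubes_finite d n).toFinset.toList.map fun a =>
    (List.ofFn a, (G a).toList.map List.ofFn)), fun a ha => ?_⟩
  ext b
  rw [decodeMap, Denumerable.ofNat_encode, mem_cubesOfList]
  simp only [List.mem_flatMap, List.mem_filter, List.mem_map, Finset.mem_toList,
    Finite.mem_toFinset, decide_eq_true_eq]
  constructor
  · rintro ⟨l, ⟨_, ⟨⟨c, hc, rfl⟩, hca⟩, hl⟩, hlb⟩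
    rw [cubeOfList_ofFn] at hca
    obtain ⟨e, he, rfl⟩ := List.mem_map.1 hl
    rw [cubeOfList_ofFn] at hlb
    rw [← hca, ← hlb]
    simpa using he
  · intro hb
    exact ⟨List.ofFn b, ⟨_, ⟨⟨a, ha, rfl⟩, cubeOfList_ofFn a⟩,
      List.mem_map.2 ⟨b, by simpa using hb, rfl⟩⟩, cubeOfList_ofFn b⟩

theorem IsFunctionName.congr {F G : ℕ → Cube d → Finset (Cube d)} {f : C(Space d, Space d)}
    (hF : IsFunctionName F f) (h : ∀ n, ∀ a ∈ boxCubes d n, G n a = F n a) :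
    IsFunctionName G f := by
  refine ⟨fun n a ha => ?_, fun n a ha b hb hba => ?_, fun m Q hQ hQ' hd => ?_⟩
  · rw [h n a ha]; exact hF.image_subset n a ha
  · rw [h n a ha, h _ b hb]; exact hF.antitone n a ha b hb hba
  · refine (hF.diam_tendsto m Q hQ hQ' hd).congr' ?_
    filter_upwards [eventually_ge_atTop m] with n hn
    rw [h n _ (hQ n hn)]

/-- Convergence of a sequence through names, at a fixed speed: some name of the limit agrees up to
the index `n` with a name of the `n`-th member. -/
def NamesConverge {X : Type*} (IsName : (ℕ → ℕ) → X → Prop) (u : ℕ → X) (x : X) : Prop :=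
  ∃ (p : ℕ → ℕ) (q : ℕ → ℕ → ℕ), IsName p x ∧ (∀ n, IsName (q n) (u n)) ∧
    ∀ n, ∀ m ≤ n, q n m = p m

theorem tendsto_of_agree {p : ℕ → ℕ} {q : ℕ → ℕ → ℕ} (h : ∀ n, ∀ m ≤ n, q n m = p m) :
    Tendsto q atTop (𝓝 p) := by
  rw [tendsto_pi_nhds]
  intro m
  refine tendsto_const_nhds.congr' ?_
  filter_upwards [eventually_ge_atTop m] with n hn
  exact (h n m hn).symm

theorem NamesConverge.converges {X : Type*} {IsName : (ℕ → ℕ) → X → Prop} {u : ℕ → X} {x : X}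
    (h : NamesConverge IsName u x) : Converges IsName u x := by
  obtain ⟨p, q, hp, hq, hlim⟩ := h
  let _ : TopologicalSpace X := finalTopology IsName
  let _ : TopologicalSpace {q : (ℕ → ℕ) × X // IsName q.1 q.2} :=
    TopologicalSpace.induced (fun q => q.1.1) inferInstance
  have hc : Continuous fun q : {q : (ℕ → ℕ) × X // IsName q.1 q.2} => q.1.2 :=
    continuous_coinduced_rng
  have ht : Tendsto (fun n => (⟨(q n, u n), hq n⟩ : {q : (ℕ → ℕ) × X // IsName q.1 q.2})) atTop
      (𝓝 ⟨(p, x), hp⟩) := by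
    rw [nhds_induced, tendsto_comap_iff]
    exact tendsto_of_agree hlim
  exact (hc.tendsto _).comp ht

theorem namesConverge_function {f : C(Space d, Space d)} {g : ℕ → C(Space d, Space d)}
    (h : ∀ n x, ‖x‖ ≤ 2 ^ (n + 1) → dist (g n x) (f x) ≤ ((2 : ℝ) ^ n)⁻¹) :
    NamesConverge (FunctionRep d) g f := by
  choose code hcode using fun n => exists_decodeMap_eq (d := d) n
  choose G hG hGF using fun n => exists_functionName_agreeing (h n)
  refine ⟨fun m => code m fun a => meetingCubes m
      (Metric.cthickening (2 * ((2 : ℝ) ^ m)⁻¹) (f '' cube m a)), fun n m => code m (G n m),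
    ?_, fun n => ?_, fun n m hm => ?_⟩
  · exact (isFunctionName_standard f).congr fun n a ha => hcode n _ a ha
  · exact (hG n).congr fun m a ha => hcode m _ a ha
  · exact congrArg (code m) (hGF n m hm)

theorem exists_closedRep (A : TopologicalSpace.Closeds (Space d)) : ∃ p, ClosedRep d p A := by
  choose code hcode using exists_decodeCubes_eq (d := d)
  refine ⟨fun m => Nat.pair (code (cubesInside m (interior (A : Set (Space d)))))
    (code (cubesInside m (A : Set (Space d))ᶜ)), ?_⟩
  simpa [ClosedRep, hcode] using isClosedName_standard A

/-- The closed set that is left when the open unit ball about `y` is removed. -/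
def compBall (y : Space d) : TopologicalSpace.Closeds (Space d) :=
  ⟨(Metric.ball y 1)ᶜ, Metric.isOpen_ball.isClosed_compl⟩

/-- The complements of unit balls that move to infinity converge to the whole space. -/
theorem namesConverge_compBall {y : ℕ → Space d} (hy : ∀ n, 2 ^ (n + 1) + 1 < ‖y n‖) :
    NamesConverge (ClosedRep d) (fun n => compBall (y n)) ⊤ := by
  choose code hcode using exists_decodeCubes_eq (d := d)
  let name (A : TopologicalSpace.Closeds (Space d)) (m : ℕ) : ℕ :=
    Nat.pair (code (cubesInside m (interior (A : Set (Space d)))))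
      (code (cubesInside m (A : Set (Space d))ᶜ))
  have hname : ∀ A, ClosedRep d (name A) A := fun A => by
    simpa [ClosedRep, name, hcode] using isClosedName_standard A
  refine ⟨name ⊤, fun n => name (compBall (y n)), hname _, fun n => hname _,
    fun n m hm => ?_⟩
  have hfar : ∀ a ∈ boxCubes d m, ∀ x ∈ cube m a, x ∉ Metric.closedBall (y n) 1 := by
    intro a ha x hx hxy
    have h1 : ‖x‖ ≤ 2 ^ (n + 1) :=
      (norm_le_of_mem_cube ha hx).trans (pow_le_pow_right₀ (by norm_num) (by omega))
    have h2 : ‖y n - x‖ ≤ 1 := by rw [← dist_eq_norm, dist_comm]; exact hxy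
    linarith [hy n, norm_sub_norm_le (y n) x]
  have hI : cubesInside m (interior (compBall (y n) : Set (Space d))) =
      cubesInside m (interior ((⊤ : TopologicalSpace.Closeds (Space d)) : Set (Space d))) := by
    ext a
    simp only [mem_cubesInside, TopologicalSpace.Closeds.coe_top, interior_univ, subset_univ,
      and_true, and_iff_left_iff_imp]
    intro ha x hx
    exact interior_maximal (t := (Metric.closedBall (y n) 1)ᶜ)
      (compl_subset_compl.2 Metric.ball_subset_closedBall)
      Metric.isClosed_closedBall.isOpen_compl (hfar a ha x hx)
  have hE : cubesInside m (compBall (y n) : Set (Space d))ᶜ =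
      cubesInside m ((⊤ : TopologicalSpace.Closeds (Space d)) : Set (Space d))ᶜ := by
    ext a
    simp only [mem_cubesInside, TopologicalSpace.Closeds.coe_top, compl_univ]
    refine and_congr_right fun ha => ?_
    obtain ⟨x, hx⟩ := cube_nonempty m a
    refine ⟨fun h => absurd (Metric.ball_subset_closedBall (?_ : x ∈ Metric.ball (y n) 1))
      (hfar a ha x hx), fun h => (h hx).elim⟩
    simpa [compBall] using h hx
  simp only [name, hI, hE]

/-! ### Approximation by escaping instances -/

theorem NamesConverge.const {X : Type*} {IsName : (ℕ → ℕ) → X → Prop} {x : X} {p : ℕ → ℕ}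
    (h : IsName p x) : NamesConverge IsName (fun _ => x) x :=
  ⟨p, fun _ => p, h, fun _ => h, fun _ _ _ => rfl⟩

/-- Without a robust invariant the instance is a limit, through names, of escaping instances. -/
theorem exists_escaping_approximations {f : C(Space d, Space d)}
    {A : TopologicalSpace.Closeds (Space d)} {x₀ : Space d} (hx : x₀ ∈ A)
    (hV : ¬ ∃ V : Set (Space d), IsRobustInvariant f V ∧ V ⊆ interior (A : Set (Space d)) ∧
      f x₀ ∈ interior V) :
    ∃ (g : ℕ → C(Space d, Space d)) (B : ℕ → TopologicalSpace.Closeds (Space d)),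
      NamesConverge (FunctionRep d) g f ∧ NamesConverge (ClosedRep d) B A ∧
      (∀ n, x₀ ∈ B n ∧ Escapes (g n) (B n) x₀) ∧ ((A : Set (Space d)) ≠ univ → ∀ n, B n = A) := by
  by_cases hA : (A : Set (Space d)) = univ
  -- the orbit is led so far away that the unit ball about its end can be removed from the space
  · have hV' : ¬ ∃ V : Set (Space d), IsRobustInvariant f V ∧ f x₀ ∈ interior V := by
      rintro ⟨V, h1, h2⟩
      exact hV ⟨V, h1, by simp [hA], h2⟩
    choose g hg k hk using fun n : ℕ => exists_perturbation_norm_gt f hV'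
      (2 ^ (n + 1) + 1 + ‖x₀‖) (ε := ((2 : ℝ) ^ n)⁻¹) (by positivity)
    obtain rfl : A = ⊤ := TopologicalSpace.Closeds.ext hA
    refine ⟨g, fun n => compBall ((g n)^[k n] x₀), namesConverge_function fun n x hxn => hg n x ?_,
      namesConverge_compBall fun n => ?_, fun n => ⟨?_, k n, ?_⟩, fun h => absurd hA h⟩
    · linarith [norm_nonneg x₀]
    · linarith [hk n, norm_nonneg x₀]
    · have h1 := hk n
      have h2 := norm_sub_norm_le ((g n)^[k n] x₀) x₀
      have h3 : (0 : ℝ) < 2 ^ (n + 1) := by positivity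
      change x₀ ∉ Metric.ball _ 1
      rw [Metric.mem_ball, dist_comm, dist_eq_norm]
      linarith
    · change ¬ (g n)^[k n] x₀ ∉ Metric.ball _ 1
      simp
  · choose g hg hesc using fun n : ℕ => exists_perturbation_escapes f hV hA
      (2 ^ (n + 1)) (ε := ((2 : ℝ) ^ n)⁻¹) (by positivity)
    obtain ⟨p, hp⟩ := exists_closedRep A
    exact ⟨g, fun _ => A, namesConverge_function hg, NamesConverge.const hp,
      fun n => ⟨hx, hesc n⟩, fun _ _ => rfl⟩

theorem converges_const {X : Type*} (IsName : (ℕ → ℕ) → X → Prop) (x : X) :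
    Converges IsName (fun _ => x) x :=
  let _ : TopologicalSpace X := finalTopology IsName
  tendsto_const_nhds

/-! ### Oracle programs -/

/-- A halting computation uses only finitely many values of the oracle. -/
theorem OracleProgram.exists_use (c : OracleProgram) {Φ : ℕ → ℕ} {n v : ℕ} (h : v ∈ c.eval Φ n) :
    ∃ N, ∀ Ψ : ℕ → ℕ, (∀ m < N, Ψ m = Φ m) → v ∈ c.eval Ψ n := by
  induction c generalizing n v with
  | zero => exact ⟨0, fun _ _ => h⟩
  | succ => exact ⟨0, fun _ _ => h⟩
  | left => exact ⟨0, fun _ _ => h⟩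
  | right => exact ⟨0, fun _ _ => h⟩
  | oracle =>
    refine ⟨n + 1, fun Ψ hΨ => ?_⟩
    simp only [eval, Part.mem_some_iff] at h ⊢
    rw [hΨ n (by omega), h]
  | pair c e ihc ihe =>
    obtain ⟨a, ha, h⟩ := Part.mem_bind_iff.1 h
    obtain ⟨b, hb, rfl⟩ := (Part.mem_map_iff _).1 h
    obtain ⟨N₁, h₁⟩ := ihc ha
    obtain ⟨N₂, h₂⟩ := ihe hb
    exact ⟨max N₁ N₂, fun Ψ hΨ => Part.mem_bind_iff.2 ⟨a, h₁ Ψ fun m hm => hΨ m (by omega),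
      (Part.mem_map_iff _).2 ⟨b, h₂ Ψ fun m hm => hΨ m (by omega), rfl⟩⟩⟩
  | comp c e ihc ihe =>
    obtain ⟨a, ha, h⟩ := Part.mem_bind_iff.1 h
    obtain ⟨N₁, h₁⟩ := ihe ha
    obtain ⟨N₂, h₂⟩ := ihc h
    exact ⟨max N₁ N₂, fun Ψ hΨ => Part.mem_bind_iff.2 ⟨a, h₁ Ψ fun m hm => hΨ m (by omega),
      h₂ Ψ fun m hm => hΨ m (by omega)⟩⟩
  | prec c e ihc ihe =>
    simp only [eval] at h ⊢
    generalize n.unpair.2 = k at h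
    induction k generalizing v with
    | zero => exact ihc h
    | succ k ih =>
      obtain ⟨a, ha, h⟩ := Part.mem_bind_iff.1 h
      obtain ⟨N₁, h₁⟩ := ih ha
      obtain ⟨N₂, h₂⟩ := ihe h
      exact ⟨max N₁ N₂, fun Ψ hΨ => Part.mem_bind_iff.2 ⟨a, h₁ Ψ fun m hm => hΨ m (by omega),
        h₂ Ψ fun m hm => hΨ m (by omega)⟩⟩
  | rfind c ih =>
    obtain ⟨h1, h2⟩ := Nat.mem_rfind.1 h
    have hall : ∀ m, ∃ N, m ≤ v → ∀ Ψ : ℕ → ℕ, (∀ l < N, Ψ l = Φ l) →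
        decide (m = v) ∈ (c.eval Ψ (Nat.pair n m)).map fun k => decide (k = 0) := by
      intro m
      by_cases hm : m ≤ v
      · have h3 : decide (m = v) ∈ (c.eval Φ (Nat.pair n m)).map fun k => decide (k = 0) := by
          rcases hm.lt_or_eq with hm | rfl
          · simpa [hm.ne] using h2 hm
          · simpa using h1
        obtain ⟨a, ha, hd⟩ := (Part.mem_map_iff _).1 h3
        obtain ⟨N, hN⟩ := ih ha
        exact ⟨N, fun _ Ψ hΨ => (Part.mem_map_iff _).2 ⟨a, hN Ψ hΨ, hd⟩⟩
      · exact ⟨0, fun h => absurd h hm⟩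
    choose N hN using hall
    have hle : ∀ m ≤ v, N m ≤ (Finset.range (v + 1)).sup N := fun m hm =>
      Finset.le_sup (Finset.mem_range.2 (by omega))
    refine ⟨(Finset.range (v + 1)).sup N, fun Ψ hΨ => Nat.mem_rfind.2 ⟨?_, fun {m} hm => ?_⟩⟩
    · simpa using hN v le_rfl Ψ fun l hl => hΨ l (hl.trans_le (hle v le_rfl))
    · simpa [hm.ne] using hN m hm.le Ψ fun l hl => hΨ l (hl.trans_le (hle m hm.le))

theorem OracleProgram.isOpen_mem_run (c : OracleProgram) (v : ℕ) :
    IsOpen {p : ℕ → ℕ | v ∈ c.run p} := by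
  rw [isOpen_iff_mem_nhds]
  intro p hp
  obtain ⟨N, hN⟩ := c.exists_use hp
  have : {q : ℕ → ℕ | ∀ m ∈ Finset.range N, q m = p m} ∈ 𝓝 p := by
    have : {q : ℕ → ℕ | ∀ m ∈ Finset.range N, q m = p m} =
        ⋂ m ∈ Finset.range N, (fun q : ℕ → ℕ => q m) ⁻¹' {p m} := by ext; simp
    rw [this]
    exact (Filter.biInter_finset_mem _).2 fun m _ =>
      (continuous_apply m).continuousAt (by simp)
  filter_upwards [this] with q hq
  exact hN q fun m hm => hq m (Finset.mem_range.2 hm)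

/-- Every partial recursive function is computed by a program that ignores the oracle. -/
theorem exists_oracleProgram {g : ℕ →. ℕ} (hg : Nat.Partrec g) :
    ∃ c : OracleProgram, ∀ Φ n, c.eval Φ n = g n := by
  induction hg with
  | zero => exact ⟨.zero, fun _ _ => rfl⟩
  | succ => exact ⟨.succ, fun _ _ => rfl⟩
  | left => exact ⟨.left, fun _ _ => rfl⟩
  | right => exact ⟨.right, fun _ _ => rfl⟩
  | pair _ _ ihf ihg =>
    obtain ⟨c, hc⟩ := ihf
    obtain ⟨e, he⟩ := ihg
    refine ⟨.pair c e, fun Φ n => ?_⟩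
    simp only [OracleProgram.eval, hc, he, Seq.seq]
    ext x
    simp
  | comp _ _ ihf ihg =>
    obtain ⟨c, hc⟩ := ihf
    obtain ⟨e, he⟩ := ihg
    refine ⟨.comp c e, fun Φ n => ?_⟩
    simp only [OracleProgram.eval, he]
    exact congrArg _ (funext (hc Φ))
  | prec _ _ ihf ihg =>
    obtain ⟨c, hc⟩ := ihf
    obtain ⟨e, he⟩ := ihg
    refine ⟨.prec c e, fun Φ n => ?_⟩
    simp only [OracleProgram.eval, hc, he, Nat.unpaired]
    rfl
  | rfind _ ihf =>
    obtain ⟨c, hc⟩ := ihf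
    refine ⟨.rfind c, fun Φ n => ?_⟩
    simp only [OracleProgram.eval, hc]
    rfl

/-! ### The stages are computable: combinatorics on lists -/

/-- The list of the coordinates of the cube that is coded by `l`. -/
def normList (d : ℕ) (l : List ℤ) : List ℤ := (List.range d).map fun i => l.getD i 0

theorem normList_eq (l : List ℤ) : normList d l = List.ofFn (cubeOfList d l) := by
  refine List.ext_getElem (by simp [normList]) fun i h1 h2 => ?_
  simp [normList, cubeOfList]

/-- `L` lists the coordinates of the members of `S`. -/
def Lists (L : List (List ℤ)) (S : Finset (Cube d)) : Prop :=
  ∀ l, l ∈ L ↔ ∃ a ∈ S, List.ofFn a = l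

theorem Lists.ofFn_mem {L : List (List ℤ)} {S : Finset (Cube d)} (h : Lists L S) {a : Cube d} :
    List.ofFn a ∈ L ↔ a ∈ S := by
  rw [h]
  exact ⟨fun ⟨b, hb, hba⟩ => List.ofFn_injective hba ▸ hb, fun ha => ⟨a, ha, rfl⟩⟩

theorem Lists.forall_mem {L : List (List ℤ)} {S : Finset (Cube d)} (h : Lists L S)
    {p : List ℤ → Prop} : (∀ l ∈ L, p l) ↔ ∀ a ∈ S, p (List.ofFn a) :=
  ⟨fun hp _ ha => hp _ (h.ofFn_mem.2 ha), fun hp l hl => by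
    obtain ⟨a, ha, rfl⟩ := (h l).1 hl
    exact hp a ha⟩

theorem Lists.exists_mem {L : List (List ℤ)} {S : Finset (Cube d)} (h : Lists L S)
    {p : List ℤ → Prop} : (∃ l ∈ L, p l) ↔ ∃ a ∈ S, p (List.ofFn a) := by
  have := h.forall_mem (p := fun l => ¬ p l)
  simpa using not_congr this

theorem lists_normList (L : List (List ℤ)) : Lists (L.map (normList d)) (cubesOfList d L) := by
  intro l
  simp only [List.mem_map, mem_cubesOfList, normList_eq]
  constructor
  · rintro ⟨l, hl, rfl⟩
    exact ⟨_, ⟨l, hl, rfl⟩, rfl⟩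
  · rintro ⟨_, ⟨l, hl, rfl⟩, rfl⟩
    exact ⟨l, hl, rfl⟩

/-- All lists whose entries differ by at most one from those of the given list. -/
def neighbourLists (l : List ℤ) : List (List ℤ) :=
  l.foldr (fun z acc => acc.flatMap fun t => [(z - 1) :: t, z :: t, (z + 1) :: t]) [[]]

theorem mem_neighbourLists {l t : List ℤ} :
    t ∈ neighbourLists l ↔ List.Forall₂ (fun z w => |w - z| ≤ 1) l t := by
  induction l generalizing t with
  | nil => simp [neighbourLists]
  | cons z l ih =>
    have h : neighbourLists (z :: l) =
        (neighbourLists l).flatMap fun t => [(z - 1) :: t, z :: t, (z + 1) :: t] := rfl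
    rw [h, List.mem_flatMap, List.forall₂_cons_left_iff]
    constructor
    · rintro ⟨s, hs, ht⟩
      simp only [List.mem_cons, List.not_mem_nil, or_false] at ht
      rcases ht with rfl | rfl | rfl <;>
      exact ⟨_, s, by simp, ih.1 hs, rfl⟩
    · rintro ⟨w, s, hw, hs, rfl⟩
      refine ⟨s, ih.2 hs, ?_⟩
      rw [abs_le] at hw
      have : w = z - 1 ∨ w = z ∨ w = z + 1 := by omega
      simpa using this

theorem forall_mem_neighbourLists {a : Cube d} {p : List ℤ → Prop} :
    (∀ t ∈ neighbourLists (List.ofFn a), p t) ↔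
      ∀ b : Cube d, (∀ i, |b i - a i| ≤ 1) → p (List.ofFn b) := by
  simp only [mem_neighbourLists]
  constructor
  · intro h b hb
    refine h _ (List.forall₂_iff_get.2 ⟨by simp, fun i h1 h2 => ?_⟩)
    simpa using hb _
  · intro h t ht
    obtain ⟨hlen, hget⟩ := List.forall₂_iff_get.1 ht
    rw [List.length_ofFn] at hlen
    subst hlen
    have ht' : List.ofFn (fun i : Fin t.length => t.get i) = t := List.ofFn_get t
    rw [← ht']
    refine h _ fun i => ?_
    simpa using hget i (by simp) i.2

theorem wellInside_iff_neighbourLists {n : ℕ} {L : List (List ℤ)} {S : Finset (Cube d)}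
    (h : Lists L S) (a : Cube d) :
    WellInside (cube n a) (body n (S : Set (Cube d))) ↔
      ∀ t ∈ neighbourLists (List.ofFn a), t ∈ L := by
  rw [wellInside_cube_body_iff, forall_mem_neighbourLists]
  simp only [h.ofFn_mem, Finset.mem_coe]

theorem encode_int_natCast (n : ℕ) : Encodable.encode (n : ℤ) = 2 * n := rfl

theorem encode_int_negSucc (n : ℕ) : Encodable.encode (Int.negSucc n) = 2 * n + 1 := rfl

/-- The encoding of the integers interleaves the non-negative and the negative ones, so a bound on
the code is a bound on the absolute value. -/
theorem mem_boxCubes_iff_encode {n : ℕ} {a : Cube d} :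
    a ∈ boxCubes d n ↔ ∀ z ∈ List.ofFn a, Encodable.encode z ≤ 2 * 4 ^ n + 1 := by
  rw [mem_boxCubes_iff, List.forall_mem_ofFn_iff]
  refine forall_congr' fun i => ?_
  have h4 : ((4 ^ n : ℕ) : ℤ) = 4 ^ n := by push_cast; rfl
  rcases a i with m | m
  · rw [Int.ofNat_eq_natCast, encode_int_natCast, ← h4]
    omega
  · rw [encode_int_negSucc, ← h4, Int.negSucc_eq]
    omega

/-- Normalize the code of a finite-set-valued map. -/
def normMap (d : ℕ) (M : List (List ℤ × List (List ℤ))) : List (List ℤ × List (List ℤ)) :=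
  M.map fun e => (normList d e.1, e.2.map (normList d))

/-- The counterpart of `setImage` for lists. -/
def setImageList (M : List (List ℤ × List (List ℤ))) (L : List (List ℤ)) : List (List ℤ) :=
  L.flatMap fun l => (M.filter fun e => e.1 = l).flatMap fun e => e.2

theorem Lists.setImage {k : ℕ} {L : List (List ℤ)} {S : Finset (Cube d)} (h : Lists L S) :
    Lists (setImageList (normMap d (Denumerable.ofNat (List (List ℤ × List (List ℤ))) k)) L)
      (setImage (decodeMap d k) S) := by
  intro t
  simp only [setImageList, normMap, PointEscape.setImage, decodeMap, List.mem_flatMap,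
    List.mem_filter, List.mem_map, decide_eq_true_eq, Finset.mem_biUnion, mem_cubesOfList]
  constructor
  · rintro ⟨l, hl, _, ⟨⟨e, he, rfl⟩, rfl⟩, ht⟩
    obtain ⟨a, ha, hae⟩ := (h _).1 hl
    obtain ⟨s, hs, rfl⟩ := List.mem_map.1 ht
    dsimp only at hae
    rw [normList_eq] at hae
    exact ⟨_, ⟨a, ha, s, ⟨e, ⟨he, (List.ofFn_injective hae).symm⟩, hs⟩, rfl⟩,
      (normList_eq s).symm⟩
  · rintro ⟨_, ⟨a, ha, s, ⟨e, ⟨he, rfl⟩, hs⟩, rfl⟩, rfl⟩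
    exact ⟨_, h.ofFn_mem.2 ha, _, ⟨⟨e, he, rfl⟩, normList_eq _⟩,
      List.mem_map.2 ⟨s, hs, normList_eq s⟩⟩

/-- The counterpart of `notExcluded` for lists. -/
def notExcludedList (E L : List (List ℤ)) : List (List ℤ) :=
  L.filter fun l => ¬ ∀ t ∈ neighbourLists l, t ∈ E

theorem Lists.notExcluded {n : ℕ} {E L : List (List ℤ)} {T S : Finset (Cube d)}
    (hE : Lists E T) (h : Lists L S) :
    Lists (notExcludedList E L) (notExcluded n T S) := by
  intro l
  simp only [notExcludedList, List.mem_filter, decide_eq_true_eq, mem_notExcluded]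
  constructor
  · rintro ⟨hl, hn⟩
    obtain ⟨a, ha, rfl⟩ := (h l).1 hl
    exact ⟨a, ⟨ha, fun hw => hn ((wellInside_iff_neighbourLists hE a).1 hw)⟩, rfl⟩
  · rintro ⟨a, ⟨ha, hw⟩, rfl⟩
    exact ⟨h.ofFn_mem.2 ha, fun hn => hw ((wellInside_iff_neighbourLists hE a).2 hn)⟩

/-- The counterpart of `LoopState` for lists. -/
abbrev ListState : Type := List (List ℤ) × List (List ℤ) × List (List ℤ)

/-- The counterpart of `initState` for lists. -/
def initList (M : List (List ℤ × List (List ℤ))) (E X : List (List ℤ)) : ListState :=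
  (setImageList M X, notExcludedList E (setImageList M X), setImageList M X)

/-- The counterpart of `nextState` for lists. -/
def nextList (M : List (List ℤ × List (List ℤ))) (E : List (List ℤ)) (s : ListState) : ListState :=
  (setImageList M s.1, notExcludedList E (setImageList M s.2.1), s.2.2 ++ setImageList M s.1)

/-- The lists of the first argument represent the three sets of the second one. -/
def ListsState (s : ListState) (t : LoopState d) : Prop :=
  Lists s.1 t.Q ∧ Lists s.2.1 t.P ∧ Lists s.2.2 t.O

theorem listsState_loopState {n k : ℕ} {E X : List (List ℤ)} {T S : Finset (Cube d)}
    (hE : Lists E T) (hX : Lists X S) (j : ℕ) :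
    ListsState
      ((nextList (normMap d (Denumerable.ofNat (List (List ℤ × List (List ℤ))) k)) E)^[j]
        (initList (normMap d (Denumerable.ofNat (List (List ℤ × List (List ℤ))) k)) E X))
      (loopState n (decodeMap d k) T S j) := by
  induction j with
  | zero => exact ⟨hX.setImage, hE.notExcluded hX.setImage, hX.setImage⟩
  | succ j ih =>
    rw [Function.iterate_succ_apply', loopState_succ]
    refine ⟨ih.1.setImage, hE.notExcluded ih.2.1.setImage, fun l => ?_⟩
    simp only [nextList, nextState, List.mem_append, Finset.mem_union]
    rw [ih.2.2 l, ih.1.setImage l]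
    constructor
    · rintro (⟨a, ha, rfl⟩ | ⟨a, ha, rfl⟩)
      exacts [⟨a, Or.inl ha, rfl⟩, ⟨a, Or.inr ha, rfl⟩]
    · rintro ⟨a, ha | ha, rfl⟩
      exacts [Or.inl ⟨a, ha, rfl⟩, Or.inr ⟨a, ha, rfl⟩]

/-- The cube with the given coordinates does not meet the box of level `n`. -/
def OutOfBox (l : List ℤ) (n : ℕ) : Prop := ∃ z ∈ l, 2 * 4 ^ n + 1 < Encodable.encode z

instance : DecidableRel OutOfBox := fun _ _ => inferInstanceAs (Decidable (∃ _ ∈ _, _))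

theorem outOfBox_iff {n : ℕ} {a : Cube d} : OutOfBox (List.ofFn a) n ↔ a ∉ boxCubes d n := by
  rw [mem_boxCubes_iff_encode, OutOfBox]
  push Not
  rfl

/-- The counterpart of `loopTests` for lists; the results are coded as `0` for `Unknown`, `1` for
`Trapped` and `2` for `Escapes`. -/
def testsList (n : ℕ) (I : List (List ℤ)) (s t : ListState) : Option ℕ :=
  if t.2.1 = [] then some 2
  else if ∃ l ∈ t.1, OutOfBox l n then some 0
  else if (∀ l ∈ s.2.2, l ∈ t.2.2) ∧ ∀ l ∈ t.2.2, l ∈ s.2.2 then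
    if ∀ l ∈ s.2.2, ∀ u ∈ neighbourLists l, u ∈ I then some 1 else some 0
  else none

/-- The code of the result of a stage. -/
def resultCode : Option Answer → ℕ
  | none => 0
  | some r => r.toNat + 1

theorem testsList_eq {n : ℕ} {I : List (List ℤ)} {T : Finset (Cube d)} {s t : ListState}
    {s' t' : LoopState d} (hI : Lists I T) (hs : ListsState s s') (ht : ListsState t t') :
    testsList n I s t = (loopTests n T s' t').map resultCode := by
  classical
  have h1 : t.2.1 = [] ↔ t'.P = ∅ := by
    rw [List.eq_nil_iff_forall_not_mem, Finset.eq_empty_iff_forall_notMem]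
    exact ht.2.1.forall_mem (p := fun _ => False)
  have h2 : (∃ l ∈ t.1, OutOfBox l n) ↔ ((t'.Q : Set (Cube d)) ∩ (boxCubes d n)ᶜ).Nonempty := by
    rw [ht.1.exists_mem]
    simp only [outOfBox_iff]
    rfl
  have h3 : ((∀ l ∈ s.2.2, l ∈ t.2.2) ∧ ∀ l ∈ t.2.2, l ∈ s.2.2) ↔ s'.O = t'.O := by
    rw [hs.2.2.forall_mem, ht.2.2.forall_mem, Finset.Subset.antisymm_iff]
    simp only [hs.2.2.ofFn_mem, ht.2.2.ofFn_mem]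
    rfl
  have h4 : (∀ l ∈ s.2.2, ∀ u ∈ neighbourLists l, u ∈ I) ↔
      WellInside (body n (s'.O : Set (Cube d))) (body n (T : Set (Cube d))) := by
    rw [hs.2.2.forall_mem, wellInside_body_iff]
    simp only [wellInside_iff_neighbourLists hI]
  unfold testsList loopTests
  simp only [apply_ite (Option.map resultCode)]
  exact if_congr h1 rfl (if_congr h2 rfl (if_congr h3 (if_congr h4 rfl rfl) rfl))

/-- One round of stage `n`, on coded input: `w` is the code of the `n`-th entries of the names. -/
def roundCode (d n w j : ℕ) : Option ℕ :=
  let M := normMap d (Denumerable.ofNat (List (List ℤ × List (List ℤ))) w.unpair.1)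
  let I := (Denumerable.ofNat (List (List ℤ)) w.unpair.2.unpair.1.unpair.1).map (normList d)
  let E := (Denumerable.ofNat (List (List ℤ)) w.unpair.2.unpair.1.unpair.2).map (normList d)
  let X := (Denumerable.ofNat (List (List ℤ)) w.unpair.2.unpair.2).map (normList d)
  if ∃ l ∈ X, ∃ t ∈ neighbourLists l, OutOfBox t n then some 0
  else if ∃ l ∈ setImageList M X, OutOfBox l n then some 0
  else testsList n I ((nextList M E)^[j] (initList M E X)) ((nextList M E)^[j + 1] (initList M E X))

theorem rfindOpt_map {α β : Type*} (g : α → β) (f : ℕ → Option α) :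
    (Nat.rfindOpt fun j => (f j).map g) = (Nat.rfindOpt f).map g := by
  ext b
  simp only [mem_rfindOpt_iff, Part.mem_map_iff, Option.map_eq_some_iff, Option.map_eq_none_iff]
  constructor
  · rintro ⟨j, ⟨a, ha, rfl⟩, h⟩
    exact ⟨a, ⟨j, ha, h⟩, rfl⟩
  · rintro ⟨a, ⟨j, ha, h⟩, rfl⟩
    exact ⟨j, ⟨a, ha, rfl⟩, h⟩

theorem rfindOpt_some {α : Type*} (a : α) : (Nat.rfindOpt fun _ => some a) = Part.some a := by
  ext b
  rw [mem_rfindOpt_iff, Part.mem_some_iff]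
  constructor
  · rintro ⟨_, h, -⟩
    exact (Option.some.inj h).symm
  · rintro rfl
    exact ⟨0, rfl, by simp⟩

/-- The search for the first decisive round computes the result of the stage. -/
theorem rfindOpt_roundCode (d n w : ℕ) :
    Nat.rfindOpt (roundCode d n w) =
      (stage n (decodeMap d w.unpair.1) (decodeCubes d w.unpair.2.unpair.1.unpair.1)
        (decodeCubes d w.unpair.2.unpair.1.unpair.2)
        (decodeCubes d w.unpair.2.unpair.2)).map resultCode := by
  have hI := lists_normList (d := d)
    (Denumerable.ofNat (List (List ℤ)) w.unpair.2.unpair.1.unpair.1)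
  have hE := lists_normList (d := d)
    (Denumerable.ofNat (List (List ℤ)) w.unpair.2.unpair.1.unpair.2)
  have hX := lists_normList (d := d) (Denumerable.ofNat (List (List ℤ)) w.unpair.2.unpair.2)
  have h1 : (∃ l ∈ (Denumerable.ofNat (List (List ℤ)) w.unpair.2.unpair.2).map (normList d),
      ∃ t ∈ neighbourLists l, OutOfBox t n) ↔
      (body n (decodeCubes d w.unpair.2.unpair.2 : Set (Cube d)) ∩
        body n (boxCubes d n)ᶜ).Nonempty := by
    rw [hX.exists_mem]
    constructor
    · rintro ⟨a, ha, hb⟩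
      by_contra hcon
      have : ∀ t ∈ neighbourLists (List.ofFn a), ¬ OutOfBox t n := by
        rw [forall_mem_neighbourLists]
        intro b hb
        rw [outOfBox_iff, not_not]
        by_contra hbn
        obtain ⟨x, hxa, hxb⟩ := cube_inter_nonempty_iff.2 hb
        exact hcon ⟨x, mem_body.2 ⟨a, ha, hxa⟩, mem_body.2 ⟨b, hbn, hxb⟩⟩
      obtain ⟨t, ht, hto⟩ := hb
      exact this t ht hto
    · rintro ⟨x, hx, hx'⟩
      obtain ⟨a, ha, hxa⟩ := mem_body.1 hx
      obtain ⟨b, hb, hxb⟩ := mem_body.1 hx'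
      refine ⟨a, ha, by_contra fun hcon => ?_⟩
      push Not at hcon
      exact forall_mem_neighbourLists.1 hcon b (cube_inter_nonempty_iff.1 ⟨x, hxa, hxb⟩)
        (outOfBox_iff.2 hb)
  have h2 : (∃ l ∈ setImageList (normMap d (Denumerable.ofNat _ w.unpair.1))
      ((Denumerable.ofNat (List (List ℤ)) w.unpair.2.unpair.2).map (normList d)), OutOfBox l n) ↔
      ((setImage (decodeMap d w.unpair.1) (decodeCubes d w.unpair.2.unpair.2) : Set (Cube d)) ∩
        (boxCubes d n)ᶜ).Nonempty := by
    rw [hX.setImage.exists_mem]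
    simp only [outOfBox_iff]
    rfl
  rw [stage_eq]
  unfold roundCode
  by_cases c1 : (body n (decodeCubes d w.unpair.2.unpair.2 : Set (Cube d)) ∩
        body n (boxCubes d n)ᶜ).Nonempty
  · simp only [if_pos c1, if_pos (h1.2 c1)]
    rw [rfindOpt_some, Part.map_some]
    rfl
  by_cases c2 : ((setImage (decodeMap d w.unpair.1) (decodeCubes d w.unpair.2.unpair.2) :
      Set (Cube d)) ∩ (boxCubes d n)ᶜ).Nonempty
  · simp only [if_neg c1, if_neg (mt h1.1 c1), if_pos c2, if_pos (h2.2 c2)]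
    rw [rfindOpt_some, Part.map_some]
    rfl
  · simp only [if_neg c1, if_neg (mt h1.1 c1), if_neg c2, if_neg (mt h2.1 c2)]
    rw [← rfindOpt_map]
    exact congrArg Nat.rfindOpt (funext fun j =>
      testsList_eq hI (listsState_loopState hE hX j) (listsState_loopState hE hX (j + 1)))

/-! ### The stages are computable: primitive recursiveness -/

theorem primrec_int_succ : Primrec fun z : ℤ => z + 1 := by
  refine Primrec.encode_iff.1 (Primrec.of_eq (f := fun z : ℤ =>
    if Encodable.encode z % 2 = 0 then Encodable.encode z + 2 else Encodable.encode z - 2) ?_ ?_)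
  · exact Primrec.ite
      (Primrec.eq.comp (Primrec.nat_mod.comp Primrec.encode (Primrec.const 2)) (Primrec.const 0))
      (Primrec.nat_add.comp Primrec.encode (Primrec.const 2))
      (Primrec.nat_sub.comp Primrec.encode (Primrec.const 2))
  · rintro (m | m)
    · have h : Encodable.encode (Int.ofNat m) = 2 * m := rfl
      rw [if_pos (by omega), h]
      rfl
    · have h := encode_int_negSucc m
      rw [if_neg (by omega), h]
      cases m with
      | zero => rfl
      | succ m =>
        rw [show Int.negSucc (m + 1) + 1 = Int.negSucc m by omega, encode_int_negSucc]
        omega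

theorem primrec_int_pred : Primrec fun z : ℤ => z - 1 := by
  refine Primrec.encode_iff.1 (Primrec.of_eq (f := fun z : ℤ =>
    if Encodable.encode z % 2 = 1 then Encodable.encode z + 2
    else if Encodable.encode z = 0 then 1 else Encodable.encode z - 2) ?_ ?_)
  · exact Primrec.ite
      (Primrec.eq.comp (Primrec.nat_mod.comp Primrec.encode (Primrec.const 2)) (Primrec.const 1))
      (Primrec.nat_add.comp Primrec.encode (Primrec.const 2))
      (Primrec.ite (Primrec.eq.comp Primrec.encode (Primrec.const 0)) (Primrec.const 1)
        (Primrec.nat_sub.comp Primrec.encode (Primrec.const 2)))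
  · rintro (m | m)
    · have h : Encodable.encode (Int.ofNat m) = 2 * m := rfl
      rw [if_neg (by omega)]
      cases m with
      | zero => rfl
      | succ m =>
        rw [if_neg (by omega), h, show Int.ofNat (m + 1) - 1 = (m : ℤ) by
          simp, encode_int_natCast]
        omega
    · have h := encode_int_negSucc m
      rw [if_pos (by omega), h, show Int.negSucc m - 1 = Int.negSucc (m + 1) by omega,
        encode_int_negSucc]
      omega

theorem primrec_normList : Primrec₂ normList :=
  Primrec.list_map (Primrec.list_range.comp Primrec.fst)
    (Primrec₂.mk ((Primrec.list_getD (0 : ℤ)).comp (Primrec.snd.comp Primrec.fst) Primrec.snd))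

theorem primrec_neighbourLists : Primrec neighbourLists := by
  refine Primrec.list_foldr (β := ℤ) (σ := List (List ℤ)) Primrec.id (Primrec.const [[]])
    (h := fun _ q => q.2.flatMap fun t => [(q.1 - 1) :: t, q.1 :: t, (q.1 + 1) :: t])
    (Primrec₂.mk ?_)
  have hz : Primrec fun q : (List ℤ × ℤ × List (List ℤ)) × List ℤ => q.1.2.1 :=
    Primrec.fst.comp (Primrec.snd.comp Primrec.fst)
  refine Primrec.list_flatMap (Primrec.snd.comp Primrec.snd) (Primrec₂.mk ?_)
  exact Primrec.list_cons.comp (Primrec.list_cons.comp (primrec_int_pred.comp hz) Primrec.snd)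
    (Primrec.list_cons.comp (Primrec.list_cons.comp hz Primrec.snd)
      (Primrec.list_cons.comp (Primrec.list_cons.comp (primrec_int_succ.comp hz) Primrec.snd)
        (Primrec.const [])))

theorem primrecRel_mem {α : Type*} [Primcodable α] :
    PrimrecRel fun (a : α) (L : List α) => a ∈ L :=
  (PrimrecRel.exists_mem_list Primrec.eq).swap.of_eq fun a L => by simp [Function.swap]

theorem primrecRel_subset {α : Type*} [Primcodable α] :
    PrimrecRel fun (L M : List α) => ∀ a ∈ L, a ∈ M :=
  PrimrecRel.forall_mem_list primrecRel_mem

theorem primrecRel_neighbours_subset :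
    PrimrecRel fun (l : List ℤ) (E : List (List ℤ)) => ∀ t ∈ neighbourLists l, t ∈ E :=
  primrecRel_subset.comp (primrec_neighbourLists.comp Primrec.fst) Primrec.snd

theorem primrecRel_outOfBox : PrimrecRel OutOfBox := by
  refine PrimrecRel.exists_mem_list (R := fun (z : ℤ) (n : ℕ) => 2 * 4 ^ n + 1 < Encodable.encode z)
    (Primrec.nat_lt.comp ?_ (Primrec.encode.comp Primrec.fst))
  have hpow : Primrec fun n : ℕ => 4 ^ n :=
    (Primrec.nat_rec₁ 1 (Primrec.nat_mul.comp Primrec.snd (Primrec.const 4)).to₂).of_eq fun n => by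
      induction n with
      | zero => rfl
      | succ n ih => rw [pow_succ, ← ih]
  exact Primrec.nat_add.comp (Primrec.nat_mul.comp (Primrec.const 2) (hpow.comp Primrec.snd))
    (Primrec.const 1)

theorem primrec_normMap : Primrec₂ normMap := by
  refine Primrec.list_map Primrec.snd (Primrec₂.mk (Primrec.pair ?_ ?_))
  · exact primrec_normList.comp (Primrec.fst.comp Primrec.fst) (Primrec.fst.comp Primrec.snd)
  · exact Primrec.list_map (Primrec.snd.comp Primrec.snd)
      (primrec_normList.comp (Primrec.fst.comp (Primrec.fst.comp Primrec.fst)) Primrec.snd).to₂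

theorem primrec_setImageList : Primrec₂ setImageList := by
  have hR : PrimrecRel fun (e : List ℤ × List (List ℤ)) (l : List ℤ) => e.1 = l :=
    Primrec.eq.comp (Primrec.fst.comp Primrec.fst) Primrec.snd
  refine Primrec.list_flatMap Primrec.snd (Primrec₂.mk ?_)
  exact Primrec.list_flatMap
    (hR.listFilter.comp (Primrec.fst.comp Primrec.fst) Primrec.snd)
    (Primrec.snd.comp Primrec.snd).to₂

theorem primrec_notExcludedList : Primrec₂ notExcludedList :=
  (PrimrecRel.listFilter (R := fun (l : List ℤ) (E : List (List ℤ)) =>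
    ¬ ∀ t ∈ neighbourLists l, t ∈ E) primrecRel_neighbours_subset.not).swap

theorem primrec_initList : Primrec fun q : List (List ℤ × List (List ℤ)) × List (List ℤ) ×
    List (List ℤ) => initList q.1 q.2.1 q.2.2 := by
  have h : Primrec fun q : List (List ℤ × List (List ℤ)) × List (List ℤ) × List (List ℤ) =>
      setImageList q.1 q.2.2 :=
    primrec_setImageList.comp Primrec.fst (Primrec.snd.comp Primrec.snd)
  exact h.pair ((primrec_notExcludedList.comp (Primrec.fst.comp Primrec.snd) h).pair h)

theorem primrec_nextList : Primrec fun q : (List (List ℤ × List (List ℤ)) × List (List ℤ)) ×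
    ListState => nextList q.1.1 q.1.2 q.2 := by
  have hM : Primrec fun q : (List (List ℤ × List (List ℤ)) × List (List ℤ)) × ListState =>
      q.1.1 := Primrec.fst.comp Primrec.fst
  have h1 := primrec_setImageList.comp hM (Primrec.fst.comp Primrec.snd)
  have h2 := primrec_setImageList.comp hM
    (Primrec.fst.comp (Primrec.snd.comp Primrec.snd))
  exact h1.pair ((primrec_notExcludedList.comp (Primrec.snd.comp Primrec.fst) h2).pair
    (Primrec.list_append.comp (Primrec.snd.comp (Primrec.snd.comp Primrec.snd)) h1))

theorem primrec_testsList : Primrec fun q : (ℕ × List (List ℤ)) × ListState × ListState =>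
    testsList q.1.1 q.1.2 q.2.1 q.2.2 := by
  have hs : Primrec fun q : (ℕ × List (List ℤ)) × ListState × ListState => q.2.1 :=
    Primrec.fst.comp Primrec.snd
  have ht : Primrec fun q : (ℕ × List (List ℤ)) × ListState × ListState => q.2.2 :=
    Primrec.snd.comp Primrec.snd
  have hsO := Primrec.snd.comp (Primrec.snd.comp hs)
  have htO := Primrec.snd.comp (Primrec.snd.comp ht)
  refine Primrec.ite (Primrec.eq.comp (Primrec.fst.comp (Primrec.snd.comp ht)) (Primrec.const []))
    (Primrec.const _) (Primrec.ite
      ((PrimrecRel.exists_mem_list primrecRel_outOfBox).comp (Primrec.fst.comp ht)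
        (Primrec.fst.comp Primrec.fst))
      (Primrec.const _) (Primrec.ite
        ((primrecRel_subset.comp hsO htO).and (primrecRel_subset.comp htO hsO))
        (Primrec.ite ((PrimrecRel.forall_mem_list primrecRel_neighbours_subset).comp hsO
            (Primrec.snd.comp Primrec.fst))
          (Primrec.const _) (Primrec.const _)) (Primrec.const _)))

theorem primrec_roundCode :
    Primrec fun q : (ℕ × ℕ × ℕ) × ℕ => roundCode q.1.1 q.1.2.1 q.1.2.2 q.2 := by
  have hd : Primrec fun q : (ℕ × ℕ × ℕ) × ℕ => q.1.1 := Primrec.fst.comp Primrec.fst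
  have hn : Primrec fun q : (ℕ × ℕ × ℕ) × ℕ => q.1.2.1 :=
    Primrec.fst.comp (Primrec.snd.comp Primrec.fst)
  have hw : Primrec fun q : (ℕ × ℕ × ℕ) × ℕ => q.1.2.2 :=
    Primrec.snd.comp (Primrec.snd.comp Primrec.fst)
  have hj : Primrec fun q : (ℕ × ℕ × ℕ) × ℕ => q.2 := Primrec.snd
  have left : ∀ {g : (ℕ × ℕ × ℕ) × ℕ → ℕ}, Primrec g → Primrec fun q => (g q).unpair.1 :=
    fun h => Primrec.fst.comp (Primrec.unpair.comp h)
  have right : ∀ {g : (ℕ × ℕ × ℕ) × ℕ → ℕ}, Primrec g → Primrec fun q => (g q).unpair.2 :=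
    fun h => Primrec.snd.comp (Primrec.unpair.comp h)
  have cubes : ∀ {g : (ℕ × ℕ × ℕ) × ℕ → ℕ}, Primrec g → Primrec fun q =>
      (Denumerable.ofNat (List (List ℤ)) (g q)).map (normList q.1.1) := fun h =>
    Primrec.list_map ((Primrec.ofNat (List (List ℤ))).comp h)
      (primrec_normList.comp (hd.comp Primrec.fst) Primrec.snd).to₂
  have hM : Primrec fun q : (ℕ × ℕ × ℕ) × ℕ => normMap q.1.1
      (Denumerable.ofNat (List (List ℤ × List (List ℤ))) q.1.2.2.unpair.1) :=
    primrec_normMap.comp hd ((Primrec.ofNat _).comp (left hw))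
  have hI := cubes (left (left (right hw)))
  have hE := cubes (right (left (right hw)))
  have hX := cubes (right (right hw))
  have hinit := primrec_initList.comp (hM.pair (hE.pair hX))
  have hiter : ∀ {g : (ℕ × ℕ × ℕ) × ℕ → ℕ}, Primrec g → Primrec fun q =>
      (nextList (normMap q.1.1
        (Denumerable.ofNat (List (List ℤ × List (List ℤ))) q.1.2.2.unpair.1))
        ((Denumerable.ofNat (List (List ℤ)) q.1.2.2.unpair.2.unpair.1.unpair.2).map
          (normList q.1.1)))^[g q] _ := fun h =>
    Primrec.nat_iterate h hinit
      (primrec_nextList.comp (((hM.pair hE).comp Primrec.fst).pair Primrec.snd)).to₂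
  have hnear : PrimrecRel fun (l : List ℤ) (n : ℕ) => ∃ t ∈ neighbourLists l, OutOfBox t n :=
    (PrimrecRel.exists_mem_list primrecRel_outOfBox).comp
      (primrec_neighbourLists.comp Primrec.fst) Primrec.snd
  exact Primrec.ite ((PrimrecRel.exists_mem_list hnear).comp hX hn) (Primrec.const _)
    (Primrec.ite ((PrimrecRel.exists_mem_list primrecRel_outOfBox).comp
        (primrec_setImageList.comp hM hX) hn) (Primrec.const _)
      (primrec_testsList.comp ((hn.pair hI).pair
        ((hiter hj).pair (hiter (Primrec.succ.comp hj))))))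

/-- The code of the result of stage `n`, with the dimension, `n` and the code of the entries of the
names as input, is a partial recursive function. -/
theorem partrec_stageCode : Nat.Partrec fun m =>
    Nat.rfindOpt (roundCode m.unpair.1 m.unpair.2.unpair.1 m.unpair.2.unpair.2) := by
  refine Partrec.nat_iff.1 (Partrec.rfindOpt (Primrec.to_comp ?_))
  have h := Primrec.unpair.comp (Primrec.fst (α := ℕ) (β := ℕ))
  exact primrec_roundCode.comp
    (((Primrec.fst.comp h).pair (Primrec.unpair.comp (Primrec.snd.comp h))).pair Primrec.snd)

/-! ### The oracle program of the algorithm -/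

/-- The Point Escape Algorithm on coded input is computed by an oracle program. -/
theorem exists_program_pointEscapeOnCode :
    ∃ c : OracleProgram, ∀ p, c.run p = (pointEscapeOnCode p).map Answer.toNat := by
  have hsub : Nat.Partrec fun m : ℕ => Part.some (1 - m) :=
    Partrec.nat_iff.1 (Primrec.nat_sub.comp (Primrec.const 1) Primrec.id).to_comp
  have hpred : Nat.Partrec fun m : ℕ => Part.some m.pred :=
    Partrec.nat_iff.1 Primrec.pred.to_comp
  -- the search for the first `n` with `1 - code = 0`, i.e. with an answer; its code is one more
  -- than the output
  obtain ⟨cs, hcs⟩ := exists_oracleProgram partrec_stageCode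
  obtain ⟨c1, hc1⟩ := exists_oracleProgram hsub
  obtain ⟨c2, hc2⟩ := exists_oracleProgram hpred
  -- on input `pair x n` the code of the result of stage `n`
  let st : OracleProgram := .comp cs (.pair (.comp .oracle .zero)
    (.pair .right (.comp .oracle (.comp .succ .right))))
  have hst : ∀ p x n, st.eval p (Nat.pair x n) =
      (stage n (decodeMap (p 0) (functionPart p n)) (decodeCubes (p 0) (closedPart p n).unpair.1)
        (decodeCubes (p 0) (closedPart p n).unpair.2)
        (decodeCubes (p 0) (pointPart p n))).map resultCode := by
    intro p x n
    simp only [st, OracleProgram.eval, Part.bind_some, Part.map_some, hcs, Nat.unpair_pair]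
    exact rfindOpt_roundCode (p 0) n (p (n + 1))
  refine ⟨.comp (.comp c2 st) (.pair .zero (.rfind (.comp c1 st))), fun p => ?_⟩
  have h1 : ∀ n, ((OracleProgram.comp c1 st).eval p (Nat.pair 0 n)).map (fun k => decide (k = 0)) =
      (stage n (decodeMap (p 0) (functionPart p n)) (decodeCubes (p 0) (closedPart p n).unpair.1)
        (decodeCubes (p 0) (closedPart p n).unpair.2)
        (decodeCubes (p 0) (pointPart p n))).map Option.isSome := by
    intro n
    simp only [OracleProgram.eval, hst, funext (hc1 p), Part.bind_some_eq_map, Part.map_map]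
    congr 1
    funext o
    cases o <;> simp [resultCode]
  have h2 : ∀ n, (OracleProgram.comp c2 st).eval p (Nat.pair 0 n) =
      (stage n (decodeMap (p 0) (functionPart p n)) (decodeCubes (p 0) (closedPart p n).unpair.1)
        (decodeCubes (p 0) (closedPart p n).unpair.2)
        (decodeCubes (p 0) (pointPart p n))).map fun o => (resultCode o).pred := by
    intro n
    simp only [OracleProgram.eval, hst, funext (hc2 p), Part.bind_some_eq_map, Part.map_map]
    rfl
  change (((Part.some 0).bind fun a => (Nat.rfind fun n => ((OracleProgram.comp c1 st).eval p
    (Nat.pair 0 n)).map fun k => decide (k = 0)).map fun b => Nat.pair a b).bind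
      ((OracleProgram.comp c2 st).eval p)) = _
  rw [Part.bind_some, Part.bind_map]
  simp only [h1, h2]
  ext v
  rw [pointEscapeOnCode, pointEscape, Part.mem_map_iff, Part.mem_bind_iff]
  constructor
  · rintro ⟨n, hn, hv⟩
    obtain ⟨o, ho, hs⟩ := (Part.mem_map_iff _).1 (Nat.rfind_spec hn)
    obtain ⟨r, rfl⟩ := Option.isSome_iff_exists.1 hs
    obtain ⟨o', ho', rfl⟩ := (Part.mem_map_iff _).1 hv
    obtain rfl := Part.mem_unique ho ho'
    exact ⟨r, Part.mem_bind_iff.2 ⟨n, hn, Part.mem_bind_iff.2 ⟨_, ho, by simp⟩⟩, rfl⟩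
  · rintro ⟨r, hr, rfl⟩
    obtain ⟨n, hn, hr⟩ := Part.mem_bind_iff.1 hr
    obtain ⟨o, ho, hr⟩ := Part.mem_bind_iff.1 hr
    rw [Part.mem_ofOption, Option.mem_def] at hr
    subst hr
    exact ⟨n, hn, (Part.mem_map_iff _).2 ⟨_, ho, rfl⟩⟩

/-! ### Completeness of the decision method -/

/-- Some robust invariant inside the interior of `A` contains `f x₀` in its interior. -/
def RobustlyTrapped (f : C(Space d, Space d)) (A : TopologicalSpace.Closeds (Space d))
    (x₀ : Space d) : Prop :=
  ∃ V : Set (Space d), IsRobustInvariant f V ∧ V ⊆ interior (A : Set (Space d)) ∧ f x₀ ∈ interior V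

theorem pointEscapeOnCode_spec {p : ℕ → ℕ} {x : Problem} (h : ProblemRep p x) :
    (∀ r ∈ pointEscapeOnCode p, (r = Answer.escapes ∧ Escapes x.f x.A x.x₀) ∨
      (r = Answer.trapped ∧ RobustlyTrapped x.f x.A x.x₀)) ∧
    (Escapes x.f x.A x.x₀ ∨ RobustlyTrapped x.f x.A x.x₀ → (pointEscapeOnCode p).Dom) := by
  obtain ⟨d, f, A, x₀, mem⟩ := x
  obtain ⟨h0, hf, hA, hX⟩ := h
  dsimp only at h0 hf hA hX ⊢
  subst h0
  refine ⟨fun r hr => ?_, ?_⟩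
  · obtain ⟨n, hn⟩ := mem_pointEscape hr
    exact escapes_or_exists_robust hf hA hX hn
  · rintro (hesc | ⟨V, hV, hVA, hfx⟩)
    · exact pointEscape_dom_of_escapes hf hA hX mem hesc
    · exact pointEscape_dom_of_robust hf hA hX hV hVA hfx

theorem not_escapes_of_robustlyTrapped {x : Problem} (h : RobustlyTrapped x.f x.A x.x₀) :
    x ∉ escapingProblems := by
  rintro ⟨n, hn⟩
  obtain ⟨V, hV, hVA, hfx⟩ := h
  exact hn (trapped_of_isRobustInvariant x.mem hV hVA hfx n)

/-- The name of an instance that is made up of the dimension and of names of the map, of the closed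
set and of the point. -/
def problemName (d : ℕ) (a b e : ℕ → ℕ) : ℕ → ℕ
  | 0 => d
  | n + 1 => Nat.pair (a n) (Nat.pair (b n) (e n))

theorem problemRep_problemName {a b e : ℕ → ℕ} {x : Problem} (ha : FunctionRep x.d a x.f)
    (hb : ClosedRep x.d b x.A) (he : PointRep x.d e x.x₀) :
    ProblemRep (problemName x.d a b e) x := by
  have h1 : functionPart (problemName x.d a b e) = a := by
    funext n; simp [functionPart, problemName]
  have h2 : closedPart (problemName x.d a b e) = b := by
    funext n; simp [closedPart, problemName]
  have h3 : pointPart (problemName x.d a b e) = e := by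
    funext n; simp [pointPart, problemName]
  rw [ProblemRep, h1, h2, h3]
  exact ⟨rfl, ha, hb, he⟩

/-- An instance that is neither escaping nor robustly trapped is a limit, through names, of escaping
instances. -/
theorem exists_escaping_problems {p : ℕ → ℕ} {x : Problem} (h : ProblemRep p x)
    (hx : ¬ RobustlyTrapped x.f x.A x.x₀) :
    ∃ u : ℕ → Problem, NamesConverge ProblemRep u x ∧ ∀ n, u n ∈ escapingProblems := by
  obtain ⟨g, B, ⟨pf, qf, hpf, hqf, haf⟩, ⟨pA, qA, hpA, hqA, haA⟩, hB, -⟩ :=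
    exists_escaping_approximations x.mem hx
  let u (n : ℕ) : Problem := ⟨x.d, g n, B n, x.x₀, (hB n).1⟩
  have hq : ∀ n, ProblemRep (problemName x.d (qf n) (qA n) (pointPart p)) (u n) := fun n =>
    problemRep_problemName (x := u n) (hqf n) (hqA n) h.2.2.2
  refine ⟨u, ⟨problemName x.d pf pA (pointPart p), _, problemRep_problemName hpf hpA h.2.2.2, hq,
    fun n m hm => ?_⟩, fun n => (hB n).2⟩
  cases m with
  | zero => rfl
  | succ m =>
    simp only [problemName]
    rw [haf n m (by omega), haA n m (by omega)]

/-- A set is open in the final topology if a program recognizes the names of its members. -/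
theorem isOpen_of_recognizable {X : Type*} {IsName : (ℕ → ℕ) → X → Prop} {U : Set X}
    (c : OracleProgram) (v : ℕ) (h : ∀ p x, IsName p x → (x ∈ U ↔ v ∈ c.run p)) :
    IsOpen[finalTopology IsName] U := by
  rw [isOpen_coinduced, isOpen_induced_iff]
  refine ⟨_, c.isOpen_mem_run v, ?_⟩
  ext q
  exact (h q.1.1 q.1.2 q.2).symm

theorem isDecisionMethod_of_run_eq {c : OracleProgram}
    (hc : ∀ p, c.run p = (pointEscapeOnCode p).map Answer.toNat) :
    IsDecisionMethod ProblemRep escapingProblems c := by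
  intro p x hp b hb
  rw [hc p] at hb
  obtain ⟨r, hr, rfl⟩ := (Part.mem_map_iff _).1 hb
  rcases (pointEscapeOnCode_spec hp).1 r hr with ⟨rfl, h⟩ | ⟨rfl, h⟩
  · exact Or.inl ⟨rfl, h⟩
  · exact Or.inr ⟨rfl, not_escapes_of_robustlyTrapped h⟩

theorem mem_haltingSet_iff {c : OracleProgram}
    (hc : ∀ p, c.run p = (pointEscapeOnCode p).map Answer.toNat) {x : Problem} :
    x ∈ haltingSet ProblemRep c ↔
      ∀ p, ProblemRep p x → x ∈ escapingProblems ∨ RobustlyTrapped x.f x.A x.x₀ := by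
  refine forall₂_congr fun p hp => ⟨fun h => ?_, fun h => ?_⟩
  · rw [hc p] at h
    obtain ⟨b, hb⟩ := Part.dom_iff_mem.1 h
    obtain ⟨r, hr, -⟩ := (Part.mem_map_iff _).1 hb
    exact ((pointEscapeOnCode_spec hp).1 r hr).imp And.right And.right
  · rw [hc p]
    exact (pointEscapeOnCode_spec hp).2 h

theorem mem_run_iff {c : OracleProgram}
    (hc : ∀ p, c.run p = (pointEscapeOnCode p).map Answer.toNat) {p : ℕ → ℕ} {x : Problem}
    (hp : ProblemRep p x) :
    (x ∈ escapingProblems ↔ 1 ∈ c.run p) ∧ (RobustlyTrapped x.f x.A x.x₀ ↔ 0 ∈ c.run p) := by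
  have hd := isDecisionMethod_of_run_eq hc p x hp
  have hdom : x ∈ escapingProblems ∨ RobustlyTrapped x.f x.A x.x₀ → ∃ b, b ∈ c.run p := fun h => by
    rw [hc p]
    exact Part.dom_iff_mem.1 ((pointEscapeOnCode_spec hp).2 h)
  refine ⟨⟨fun h => ?_, fun h => ?_⟩, ⟨fun h => ?_, fun h => ?_⟩⟩
  · obtain ⟨b, hb⟩ := hdom (Or.inl h)
    rcases hd b hb with ⟨rfl, -⟩ | ⟨-, hn⟩
    exacts [hb, absurd h hn]
  · exact (hd 1 h).elim And.right fun h => absurd h.1 one_ne_zero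
  · obtain ⟨b, hb⟩ := hdom (Or.inr h)
    rcases hd b hb with ⟨-, hn⟩ | ⟨rfl, -⟩
    exacts [absurd hn (not_escapes_of_robustlyTrapped h), hb]
  · rw [hc p] at h
    obtain ⟨r, hr, hr0⟩ := (Part.mem_map_iff _).1 h
    rcases (pointEscapeOnCode_spec hp).1 r hr with ⟨rfl, -⟩ | ⟨-, h⟩
    exacts [absurd hr0 one_ne_zero, h]

/-- The halting set of the algorithm is the complement of the boundary: the escaping instances are
recognized by the answer `1`, the robustly trapped ones by the answer `0`, and every other instance
is a trapped limit of escaping instances. -/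
theorem isCompleteDecisionMethod_of_run_eq {c : OracleProgram}
    (hc : ∀ p, c.run p = (pointEscapeOnCode p).map Answer.toNat) :
    IsCompleteDecisionMethod ProblemRep escapingProblems c := by
  refine ⟨isDecisionMethod_of_run_eq hc, ?_⟩
  let _ : TopologicalSpace Problem := finalTopology ProblemRep
  have hS : IsOpen escapingProblems :=
    isOpen_of_recognizable c 1 fun p x hp => (mem_run_iff hc hp).1
  ext x
  rw [mem_haltingSet_iff hc, mem_compl_iff]
  constructor
  · intro h
    by_cases hx : x ∈ escapingProblems
    · intro hfr
      have : x ∈ escapingProblems ∩ frontier escapingProblems := ⟨hx, hfr⟩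
      rw [hS.inter_frontier_eq] at this
      exact this
    -- the condition `y ∉ escapingProblems` only matters for instances without names
    · have hT : IsOpen {y : Problem | y ∉ escapingProblems ∧
          ∀ p, ProblemRep p y → RobustlyTrapped y.f y.A y.x₀} := by
        refine isOpen_of_recognizable c 0 fun p y hp => ?_
        rw [← (mem_run_iff hc hp).2]
        exact ⟨fun hy => hy.2 p hp, fun hy => ⟨not_escapes_of_robustlyTrapped hy, fun _ _ => hy⟩⟩
      intro hfr
      obtain ⟨y, hyT, hyS⟩ := mem_closure_iff.1 (frontier_subset_closure hfr) _ hT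
        ⟨hx, fun p hp => (h p hp).resolve_left hx⟩
      exact hyT.1 hyS
  · intro hfr p hp
    by_contra! hcon
    obtain ⟨u, hu, huS⟩ := exists_escaping_problems hp hcon.2
    have hlim : Tendsto u atTop (𝓝 x) := hu.converges
    exact hfr ⟨mem_closure_of_tendsto hlim (Eventually.of_forall huS),
      fun hi => hcon.1 (interior_subset hi)⟩

/-- No decision method halts on an instance on which the algorithm may run forever: its answer on a
suitable name would be the same for escaping instances nearby. -/
theorem haltingSet_subset_of_isDecisionMethod {c c' : OracleProgram}
    (hc : ∀ p, c.run p = (pointEscapeOnCode p).map Answer.toNat)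
    (hc' : IsDecisionMethod ProblemRep escapingProblems c') :
    haltingSet ProblemRep c' ⊆ haltingSet ProblemRep c := by
  intro x hx
  rw [mem_haltingSet_iff hc]
  intro p hp
  by_contra! hcon
  obtain ⟨u, ⟨p', q, hp', hq, hagree⟩, huS⟩ := exists_escaping_problems hp hcon.2
  obtain ⟨b, hb⟩ := Part.dom_iff_mem.1 (hx p' hp')
  rcases hc' p' x hp' b hb with ⟨-, h⟩ | ⟨rfl, -⟩
  · exact hcon.1 h
  obtain ⟨N, hN⟩ := c'.exists_use hb
  rcases hc' (q N) (u N) (hq N) 0 (hN (q N) fun m hm => hagree N m hm.le) with ⟨h, -⟩ | ⟨-, h⟩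
  · exact zero_ne_one h
  · exact h (huS N)

end PointEscape
end

open PointEscape
theorem mainTheorem1 :
    (∀ (d : ℕ) (f : C(Space d, Space d)) (A : TopologicalSpace.Closeds (Space d)) (x₀ : Space d),
      x₀ ∈ A →
      ∀ (F : ℕ → Cube d → Finset (Cube d)) (I E X : ℕ → Finset (Cube d)),
      IsFunctionName F f → IsClosedName I E A → IsPointName X x₀ →
        (∀ r ∈ pointEscape F I E X,
          (r = Answer.escapes ∧ Escapes f A x₀) ∨ (r = Answer.trapped ∧ Trapped f A x₀)) ∧
        (Escapes f A x₀ → (pointEscape F I E X).Dom) ∧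
        ((∃ V : Set (Space d), IsRobustInvariant f V ∧ V ⊆ interior (A : Set (Space d)) ∧
            f x₀ ∈ interior V) → (pointEscape F I E X).Dom) ∧
        (¬ (pointEscape F I E X).Dom →
          (∃ (f₀ f₁ : ℕ → C(Space d, Space d)) (A₀ A₁ : ℕ → TopologicalSpace.Closeds (Space d)),
            Converges (FunctionRep d) f₀ f ∧ Converges (FunctionRep d) f₁ f ∧
            Converges (ClosedRep d) A₀ A ∧ Converges (ClosedRep d) A₁ A ∧
            ∀ n, x₀ ∈ A₀ n ∧ Escapes (f₀ n) (A₀ n) x₀ ∧ x₀ ∈ A₁ n ∧ Trapped (f₁ n) (A₁ n) x₀) ∧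
          ((A : Set (Space d)) ≠ Set.univ →
            ∃ f₀ f₁ : ℕ → C(Space d, Space d),
              Converges (FunctionRep d) f₀ f ∧ Converges (FunctionRep d) f₁ f ∧
              ∀ n, Escapes (f₀ n) A x₀ ∧ Trapped (f₁ n) A x₀))) ∧
    (∃ c : OracleProgram,
      (∀ p x, ProblemRep p x → c.run p = (pointEscapeOnCode p).map Answer.toNat) ∧
      IsCompleteDecisionMethod ProblemRep escapingProblems c ∧
      ∀ c' : OracleProgram, IsDecisionMethod ProblemRep escapingProblems c' →
        haltingSet ProblemRep c' ⊆ haltingSet ProblemRep c) := by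
  refine ⟨fun d f A x₀ hx F I E X hF hA hX => ?_, ?_⟩
  · have hesc := pointEscape_dom_of_escapes hF hA hX hx
    have hrob : RobustlyTrapped f A x₀ → (pointEscape F I E X).Dom := fun ⟨_, hV, hVA, hfx⟩ =>
      pointEscape_dom_of_robust hF hA hX hV hVA hfx
    refine ⟨fun r hr => ?_, hesc, hrob, fun hdom => ?_⟩
    · obtain ⟨n, hn⟩ := mem_pointEscape hr
      refine (escapes_or_exists_robust hF hA hX hn).imp_right fun ⟨h, V, hV, hVA, hfx⟩ => ⟨h, ?_⟩
      exact trapped_of_isRobustInvariant hx hV hVA hfx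
    · have htr : Trapped f A x₀ := fun n => by_contra fun hn => hdom (hesc ⟨n, hn⟩)
      obtain ⟨g, B, hg, hB, hgB, hBA⟩ := exists_escaping_approximations hx (mt hrob hdom)
      refine ⟨⟨g, fun _ => f, B, fun _ => A, hg.converges, converges_const _ _, hB.converges,
        converges_const _ _, fun n => ⟨(hgB n).1, (hgB n).2, hx, htr⟩⟩, fun hne =>
        ⟨g, fun _ => f, hg.converges, converges_const _ _, fun n => ⟨?_, htr⟩⟩⟩
      have := (hgB n).2
      rwa [hBA hne n] at this
  · obtain ⟨c, hc⟩ := exists_program_pointEscapeOnCode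
    exact ⟨c, fun p _ _ => hc p, isCompleteDecisionMethod_of_run_eq hc,
      fun c' hc' => haltingSet_subset_of_isDecisionMethod hc hc'⟩
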